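/- Let $\mathcal X=(X,\rho,\mu)$ denote a metric measure space, that is, a nonempty bounded metric space $(X,\rho)$ with a Borel measure $\mu$ such that $\mu(X)<\infty$ and every open ball $B(x,s)=\{y:\rho(x,y)<s\}$, $s>0$, has positive measure. It is called nondoubling if there is no $C<\infty$ with $\mu(B(x,2s))\le C\mu(B(x,s))$ for all $x\in X$, $s>0$. The centered Hardy--Littlewood maximal function of a Borel function $f:X\to\mathbb C$ is $$\mathcal M_{\mathcal X}f(x)=\sup_{s>0}\frac1{\mu(B(x,s))}\int_{B(x,s)}|f|\,d\mu .$$ For $p\in[1,\infty)$ and $q\in[1,\infty]$ let $\|f\|_{p,q}=p^{1/q}\big(\int_0^\infty (t\,d_f(t)^{1/p})^q\,\frac{dt}{t}\big)^{1/q}$ if $q<\infty$ and $\|f\|_{p,\infty}=\sup_{t>0}t\,d_f(t)^{1/p}$, where $d_f(t)=\mu(\{x:|f(x)|>t\})$; the Lorentz space $L^{p,q}(\mathcal X)$ consists of the Borel functions $f$ with $\|f\|_{p,q}<\infty$. Let $\mathbf c(p,q,r,\mathcal X)\in[0,\infty]$ be the smallest constant $c$ such that $\|\mathcal M_{\mathcal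 X}f\|_{p,r}\le c\,\|f\|_{p,q}$ for all $f\in L^{p,q}(\mathcal X)$, with $\mathbf c(p,q,r,\mathcal X)=\infty$ if there is no finite such constant. A triple $(p,q,r)$ is admissible if either $p=q=1$ and $r\in[1,\infty]$, or $p\in(1,\infty)$ and $q,r\in[1,\infty]$ with $q\le r$. For each admissible triple $(p_0,q_0,r_0)$ the following hold. (i) There exists a nondoubling metric measure space $\mathcal Z$ such that $\mathbf c(p_0,q_0,r,\mathcal Z)=\infty$ for all $r\in[q_0,r_0]$, while $\mathbf c(p_0,q_0,r,\mathcal Z)<\infty$ for all $r\in(r_0,\infty]$. (ii) There exists a nondoubling metric measure space $\mathcal Z'$ such that $\mathbf c(p_0,q_0,r,\mathcal Z')=\infty$ for all $r\in[q_0,r_0)$, while $\mathbf c(p_0,q_0,r,\mathcal Z')<\infty$ for all $r\in[r_0,\infty]$. Here $[v,v)=(v,v]=\emptyset$ and $[v,v]=\{v\}$ for $v \in \mathbb R\cup\{\infty\}$. -/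

import Mathlib

open Set MeasureTheory
open scoped ENNReal NNReal

namespace LorentzMaximal

noncomputable section

/-- The Lorentz quasinorm `‖g‖_{p,q}`, `p ∈ [1, ∞)`, `q ∈ [1, ∞]`, of a function `g` with values
in `[0, ∞]`, through its distribution function `t ↦ μ {x | t < g x}`. -/
def lorentzNorm {X : Type*} [MeasurableSpace X] (μ : Measure X) (p : ℝ) (q : ℝ≥0∞)
    (g : X → ℝ≥0∞) : ℝ≥0∞ :=
  if q = ∞ then
    ⨆ (t : ℝ) (_ : 0 < t), ENNReal.ofReal t * μ {x | ENNReal.ofReal t < g x} ^ (1 / p)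
  else
    ENNReal.ofReal p ^ (1 / q.toReal) *
      (∫⁻ t in Ioi (0 : ℝ),
        (ENNReal.ofReal t * μ {x | ENNReal.ofReal t < g x} ^ (1 / p)) ^ q.toReal
          / ENNReal.ofReal t) ^ (1 / q.toReal)

/-- The centered Hardy--Littlewood maximal function (open balls). -/
def maximalFunction {X : Type*} [MetricSpace X] [MeasurableSpace X] (μ : Measure X)
    (f : X → ℂ) (x : X) : ℝ≥0∞ :=
  ⨆ (s : ℝ) (_ : 0 < s),
    (∫⁻ y in Metric.ball x s, ‖f y‖ₑ ∂μ) / μ (Metric.ball x s)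

/-- The optimal constant in `‖M f‖_{p,r} ≤ c ‖f‖_{p,q}`, `f ∈ L^{p,q}`; it is `∞` if there is no
finite constant. -/
def bestConstant {X : Type*} [MetricSpace X] [MeasurableSpace X] (μ : Measure X)
    (p : ℝ) (q r : ℝ≥0∞) : ℝ≥0∞ :=
  ⨅ (c : ℝ≥0) (_ : ∀ f : X → ℂ, Measurable f → lorentzNorm μ p q (fun x => ‖f x‖ₑ) < ∞ →
      lorentzNorm μ p r (maximalFunction μ f) ≤ c * lorentzNorm μ p q (fun x => ‖f x‖ₑ)),
    (c : ℝ≥0∞)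

/-- Admissible triples `(p, q, r)`. -/
def Admissible (p : ℝ) (q r : ℝ≥0∞) : Prop :=
  (p = 1 ∧ q = 1 ∧ 1 ≤ r) ∨ (1 < p ∧ 1 ≤ q ∧ q ≤ r)

/-- The standing assumptions on a metric measure space: it is nonempty and bounded, its total
measure is finite, and every ball has positive measure. -/
structure IsStandard {X : Type*} [MetricSpace X] [MeasurableSpace X] (μ : Measure X) : Prop where
  nonempty : Nonempty X
  bounded : Bornology.IsBounded (univ : Set X)
  finite : μ univ < ∞
  ball_pos : ∀ (x : X) (s : ℝ), 0 < s → 0 < μ (Metric.ball x s)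

/-- The doubling condition. -/
def IsDoubling {X : Type*} [MetricSpace X] [MeasurableSpace X] (μ : Measure X) : Prop :=
  ∃ C : ℝ≥0, ∀ (x : X) (s : ℝ), 0 < s → μ (Metric.ball x (2 * s)) ≤ C * μ (Metric.ball x s)

end

end LorentzMaximal

namespace LorentzMaximal

/-! The space is a disjoint family of stars, designed so that the maximal operator reduces, up to
harmless terms, to one explicit map whose `L^{p,q} → L^{p,r}` boundedness is a condition on `ℓ^r`
norms. Star `n` has a hub of mass `m_n = 2^{-e n}`. For each `k ≤ n` it has `2^k` leaves of mass
`m_n`, joined to the hub, and each leaf carries a tip of mass `m_n D_{n,k}` with `D_{n,k} ≥ 1`.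
Distances are 0, 1 or 2, so a ball is a point, a point with its neighbours, or everything.

The ball of radius 2 around a leaf is {leaf, hub, tip}, of mass comparable to `m_n D_{n,k}`, so
there `M f` sees the hub as `f(hub) / D_{n,k}`; this is `transfer`. All other contributions are
dominated by `averaging`, which is bounded on `L^1` and `L^∞`, hence on `L^{p,q}` for `p > 1` by
Marcinkiewicz interpolation. As `L^{p,q} ⊆ L^{p,r}` for `q ≤ r` (`exists_dilationNorm_le_of_le`),
this part is bounded for every admissible triple.

Level `(n, k)` has total mass `2^k m_n`. With `e` growing fast, these masses are distinct powers of
2, and then the `L^{p,r}` norm of a function constant on levels is comparable to the `ℓ^r` norm of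
value times mass`^{1/p}` (`exists_dilationNorm_familyDist_le`, `exists_familyNorm_le_dilationNorm`).
So `transfer` multiplies the size of hub `n` by the `ℓ^r` norm over `k ≤ n` of `b_{n,k} = 2^{k/p} /
D_{n,k}`, and `M` is bounded iff these norms are bounded in `n` (`exists_space_of_array`). Here `b`
is any positive array with `b_{n,k} ≤ 2^{k/p}`.

It remains to choose `b`. For (i), `b_{n,k} = (k+1)^{-1/r₀}` lies in `ℓ^r` exactly for `r > r₀`, and
`D = 1` makes every `r` fail when `r₀ = ∞`. For (ii), `b_{n,k} = (n+1)^{-1/r₀}` has norms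
`(n+1)^{1/r - 1/r₀}`, bounded exactly for `r ≥ r₀`. -/

/-! ### Lorentz norms as dilation-invariant norms of profiles, and their nesting in the second
index. -/

/-- The `L^q` norm on `(0, ∞)` with respect to the dilation invariant measure `dt / t`, with the
true supremum for `q = ∞`. -/
noncomputable def dilationNorm (q : ℝ≥0∞) (φ : ℝ → ℝ≥0∞) : ℝ≥0∞ :=
  if q = ∞ then ⨆ (t : ℝ) (_ : 0 < t), φ t
  else (∫⁻ t in Ioi (0 : ℝ), φ t ^ q.toReal / ENNReal.ofReal t) ^ (1 / q.toReal)

/-- The profile `t ↦ t d(t)^{1/p}` attached to a distribution function `d`. -/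
noncomputable def profile (p : ℝ) (d : ℝ → ℝ≥0∞) (t : ℝ) : ℝ≥0∞ :=
  ENNReal.ofReal t * d t ^ (1 / p)

theorem lorentzNorm_eq {X : Type*} [MeasurableSpace X] (μ : Measure X) (p : ℝ) (q : ℝ≥0∞)
    (g : X → ℝ≥0∞) :
    lorentzNorm μ p q g = (if q = ∞ then 1 else ENNReal.ofReal p ^ (1 / q.toReal)) *
      dilationNorm q (profile p fun t => μ {x | ENNReal.ofReal t < g x}) := by
  unfold lorentzNorm dilationNorm profile
  split_ifs <;> simp

theorem dilationNorm_top (φ : ℝ → ℝ≥0∞) : dilationNorm ∞ φ = ⨆ (t : ℝ) (_ : 0 < t), φ t :=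
  if_pos rfl

theorem dilationNorm_of_ne_top {q : ℝ≥0∞} (hq : q ≠ ∞) (φ : ℝ → ℝ≥0∞) :
    dilationNorm q φ =
      (∫⁻ t in Ioi (0 : ℝ), φ t ^ q.toReal / ENNReal.ofReal t) ^ (1 / q.toReal) :=
  if_neg hq

theorem one_le_toReal {q : ℝ≥0∞} (hq : q ≠ ∞) (h1 : 1 ≤ q) : 1 ≤ q.toReal := by
  simpa using ENNReal.toReal_mono hq h1

theorem dilationNorm_rpow {q : ℝ≥0∞} (hq : q ≠ ∞) (h1 : 1 ≤ q) (φ : ℝ → ℝ≥0∞) :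
    dilationNorm q φ ^ q.toReal = ∫⁻ t in Ioi (0 : ℝ), φ t ^ q.toReal / ENNReal.ofReal t := by
  have := one_le_toReal hq h1
  rw [dilationNorm_of_ne_top hq, ← ENNReal.rpow_mul, one_div_mul_cancel (by positivity),
    ENNReal.rpow_one]

theorem dilationNorm_mono (q : ℝ≥0∞) {φ ψ : ℝ → ℝ≥0∞} (h : ∀ t, 0 < t → φ t ≤ ψ t) :
    dilationNorm q φ ≤ dilationNorm q ψ := by
  unfold dilationNorm
  split_ifs
  · exact iSup₂_mono h
  · refine ENNReal.rpow_le_rpow (setLIntegral_mono_ae' measurableSet_Ioi ?_) (by positivity)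
    filter_upwards with t ht
    gcongr
    exact h t ht

theorem dilationNorm_const_mul {q : ℝ≥0∞} (h1 : 1 ≤ q) {c : ℝ≥0∞} (hc : c ≠ ∞)
    (φ : ℝ → ℝ≥0∞) : dilationNorm q (fun t => c * φ t) = c * dilationNorm q φ := by
  by_cases hq : q = ∞
  · subst hq
    simp only [dilationNorm_top, ENNReal.mul_iSup]
  · have := one_le_toReal hq h1
    rw [dilationNorm_of_ne_top hq, dilationNorm_of_ne_top hq]
    simp_rw [ENNReal.mul_rpow_of_nonneg _ _ (zero_le_one.trans this), mul_div_assoc]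
    rw [lintegral_const_mul' _ _ (ENNReal.rpow_ne_top_of_nonneg (by positivity) hc),
      ENNReal.mul_rpow_of_nonneg _ _ (by positivity), ← ENNReal.rpow_mul,
      mul_one_div_cancel (by positivity), ENNReal.rpow_one]

theorem setLIntegral_Ioi_comp_mul_left (F : ℝ → ℝ≥0∞) {a : ℝ} (ha : 0 < a) :
    ENNReal.ofReal a * ∫⁻ t in Ioi (0 : ℝ), F (a * t) = ∫⁻ t in Ioi (0 : ℝ), F t := by
  have hmap := Real.smul_map_volume_mul_left ha.ne'
  have he : MeasurableEmbedding (fun t : ℝ => a * t) :=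
    (Homeomorph.mulLeft₀ a ha.ne').measurableEmbedding
  have hpre : (fun t : ℝ => a * t) ⁻¹' Ioi 0 = Ioi 0 := by
    ext t; simp [ha]
  conv_rhs => rw [← hmap]
  rw [Measure.restrict_smul, lintegral_smul_measure, he.restrict_map, he.lintegral_map, hpre,
    abs_of_pos ha, smul_eq_mul]

theorem dilationNorm_comp_mul_left (q : ℝ≥0∞) (φ : ℝ → ℝ≥0∞) {a : ℝ} (ha : 0 < a) :
    dilationNorm q (fun t => φ (a * t)) = dilationNorm q φ := by
  by_cases hq : q = ∞
  · subst hq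
    simp only [dilationNorm_top]
    refine le_antisymm (iSup₂_le fun t ht => ?_) (iSup₂_le fun t ht => ?_)
    · exact le_iSup₂_of_le (a * t) (mul_pos ha ht) le_rfl
    · refine le_iSup₂_of_le (t / a) (div_pos ht ha) (le_of_eq ?_)
      rw [mul_div_cancel₀ _ ha.ne']
  · rw [dilationNorm_of_ne_top hq, dilationNorm_of_ne_top hq,
      ← setLIntegral_Ioi_comp_mul_left (fun t => φ t ^ q.toReal / ENNReal.ofReal t) ha,
      ← lintegral_const_mul' _ _ ENNReal.ofReal_ne_top]
    congr 1
    refine setLIntegral_congr_fun measurableSet_Ioi fun t ht => ?_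
    have h0 : ENNReal.ofReal a ≠ 0 := by simpa using ha
    simp only [ENNReal.ofReal_mul ha.le]
    rw [div_eq_mul_inv, div_eq_mul_inv,
      ENNReal.mul_inv (Or.inl h0) (Or.inl ENNReal.ofReal_ne_top), mul_left_comm,
      ← mul_assoc (ENNReal.ofReal a),
      ENNReal.mul_inv_cancel h0 ENNReal.ofReal_ne_top, one_mul]

/-- Absorbing the density `1/t` into the functions as a factor `t^{-1/q}` turns this into
Minkowski's inequality for Lebesgue measure. -/
theorem dilationNorm_add_le {q : ℝ≥0∞} (h1 : 1 ≤ q) {φ ψ : ℝ → ℝ≥0∞} (hφ : Measurable φ)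
    (hψ : Measurable ψ) :
    dilationNorm q (fun t => φ t + ψ t) ≤ dilationNorm q φ + dilationNorm q ψ := by
  by_cases hq : q = ∞
  · subst hq
    simp only [dilationNorm_top]
    exact iSup₂_le fun t ht => add_le_add (le_iSup₂ (f := fun t _ => φ t) t ht)
      (le_iSup₂ (f := fun t _ => ψ t) t ht)
  · have hq1 := one_le_toReal hq h1
    have key : ∀ χ : ℝ → ℝ≥0∞, dilationNorm q χ =
        (∫⁻ t in Ioi (0 : ℝ), (χ t * (ENNReal.ofReal t)⁻¹ ^ (1 / q.toReal)) ^ q.toReal) ^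
          (1 / q.toReal) := by
      intro χ
      rw [dilationNorm_of_ne_top hq]
      congr 1
      refine lintegral_congr fun t => ?_
      rw [ENNReal.mul_rpow_of_nonneg _ _ (by positivity), ← ENNReal.rpow_mul,
        one_div_mul_cancel (by positivity), ENNReal.rpow_one, div_eq_mul_inv]
    rw [key, key, key]
    simp_rw [add_mul]
    have hm : Measurable fun t : ℝ => (ENNReal.ofReal t)⁻¹ ^ (1 / q.toReal) := by fun_prop
    exact ENNReal.lintegral_Lp_add_le (hφ.mul hm).aemeasurable (hψ.mul hm).aemeasurable hq1

theorem dilationNorm_zero {q : ℝ≥0∞} (h1 : 1 ≤ q) : dilationNorm q (fun _ => 0) = 0 := by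
  simpa using dilationNorm_const_mul h1 (c := 0) (by simp) (fun _ => 0)

theorem dilationNorm_sum_le {q : ℝ≥0∞} (h1 : 1 ≤ q) {φ : ℕ → ℝ → ℝ≥0∞}
    (hφ : ∀ j, Measurable (φ j)) (n : ℕ) :
    dilationNorm q (fun t => ∑ j ∈ Finset.range n, φ j t) ≤
      ∑ j ∈ Finset.range n, dilationNorm q (φ j) := by
  induction n with
  | zero => simp [dilationNorm_zero h1]
  | succ n ih =>
    simp_rw [Finset.sum_range_succ]
    exact (dilationNorm_add_le h1 (Finset.measurable_sum _ fun j _ => hφ j) (hφ n)).trans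
      (add_le_add ih le_rfl)

theorem dilationNorm_tsum_le {q : ℝ≥0∞} (h1 : 1 ≤ q) {φ : ℕ → ℝ → ℝ≥0∞}
    (hφ : ∀ j, Measurable (φ j)) :
    dilationNorm q (fun t => ∑' j, φ j t) ≤ ∑' j, dilationNorm q (φ j) := by
  have hfin : ∀ n, dilationNorm q (fun t => ∑ j ∈ Finset.range n, φ j t) ≤
      ∑' j, dilationNorm q (φ j) := fun n =>
    (dilationNorm_sum_le h1 hφ n).trans (ENNReal.sum_le_tsum _)
  by_cases hq : q = ∞
  · subst hq
    simp only [dilationNorm_top] at hfin ⊢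
    refine iSup₂_le fun t ht => ?_
    rw [ENNReal.tsum_eq_iSup_nat]
    refine iSup_le fun n => le_trans ?_ (hfin n)
    exact le_iSup₂ (f := fun t _ => ∑ j ∈ Finset.range n, φ j t) t ht
  · have hq1 := one_le_toReal hq h1
    have hq0 : 0 < q.toReal := by positivity
    rw [dilationNorm_of_ne_top hq, one_div, ENNReal.rpow_inv_le_iff hq0]
    have hlim : Filter.Tendsto
        (fun n => ∫⁻ t in Ioi (0 : ℝ),
          (∑ j ∈ Finset.range n, φ j t) ^ q.toReal / ENNReal.ofReal t) Filter.atTop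
        (nhds (∫⁻ t in Ioi (0 : ℝ), (∑' j, φ j t) ^ q.toReal / ENNReal.ofReal t)) := by
      refine lintegral_tendsto_of_tendsto_of_monotone (fun n => ?_) ?_ ?_
      · have : Measurable fun t => ∑ j ∈ Finset.range n, φ j t :=
          Finset.measurable_sum _ fun j _ => hφ j
        fun_prop
      · refine Filter.Eventually.of_forall fun t m n hmn => ?_
        dsimp only
        gcongr
      · refine (ae_restrict_iff' measurableSet_Ioi).2 (Filter.Eventually.of_forall fun t ht => ?_)
        refine ENNReal.Tendsto.div_const ?_ (Or.inr (by simpa using ht))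
        exact ((ENNReal.continuous_rpow_const (y := q.toReal)).tendsto _).comp
          ENNReal.summable.hasSum.tendsto_sum_nat
    refine le_of_tendsto' hlim fun n => ?_
    rw [← dilationNorm_rpow hq h1]
    exact ENNReal.rpow_le_rpow (hfin n) hq0.le

theorem measurable_profile {p : ℝ} {d : ℝ → ℝ≥0∞} (hd : Antitone d) :
    Measurable (profile p d) := by
  unfold profile
  have := hd.measurable
  fun_prop

theorem lintegral_Ioo_rpow_div {q : ℝ} (hq : 0 < q) {c : ℝ} (hc : 0 ≤ c) :
    ∫⁻ t in Ioo (0 : ℝ) c, ENNReal.ofReal t ^ q / ENNReal.ofReal t =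
      ENNReal.ofReal c ^ q / ENNReal.ofReal q := by
  have hint : IntervalIntegrable (fun t : ℝ => t ^ (q - 1)) volume 0 c :=
    intervalIntegral.intervalIntegrable_rpow' (by linarith)
  have hcongr : ∫⁻ t in Ioo (0 : ℝ) c, ENNReal.ofReal t ^ q / ENNReal.ofReal t =
      ∫⁻ t in Ioo (0 : ℝ) c, ENNReal.ofReal (t ^ (q - 1)) := by
    refine setLIntegral_congr_fun measurableSet_Ioo fun t ht => ?_
    rw [ENNReal.ofReal_rpow_of_pos ht.1, ← ENNReal.ofReal_div_of_pos ht.1,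
      Real.rpow_sub_one ht.1.ne']
  rw [hcongr, setLIntegral_congr Ioo_ae_eq_Ioc, ← ofReal_integral_eq_lintegral_ofReal,
    ← intervalIntegral.integral_of_le hc, integral_rpow (Or.inl (by linarith)), sub_add_cancel,
    Real.zero_rpow hq.ne', sub_zero, ENNReal.ofReal_div_of_pos hq,
    ENNReal.ofReal_rpow_of_nonneg hc hq.le]
  · exact (intervalIntegrable_iff_integrableOn_Ioc_of_le hc).1 hint
  · refine (ae_restrict_iff' measurableSet_Ioc).2 (Filter.Eventually.of_forall fun t ht => ?_)
    exact Real.rpow_nonneg ht.1.le _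

theorem profile_rpow {p q : ℝ} (hq : 0 < q) (d : ℝ → ℝ≥0∞) (t : ℝ) :
    profile p d t ^ q = ENNReal.ofReal t ^ q * d t ^ (q / p) := by
  rw [profile, ENNReal.mul_rpow_of_nonneg _ _ hq.le, ← ENNReal.rpow_mul, one_div_mul_eq_div]

/-- On `(0, t)` the distribution function is at least `d t`, and the integral of `s^{q-1}` over `(0,
t)` is `t^q / q`. -/
theorem profile_le_dilationNorm {p : ℝ} (hp : 0 < p) {q : ℝ≥0∞} (hq : q ≠ ∞) (h1 : 1 ≤ q)
    {d : ℝ → ℝ≥0∞} (hd : Antitone d) {t : ℝ} (ht : 0 < t) :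
    profile p d t ≤ ENNReal.ofReal q.toReal ^ (1 / q.toReal) * dilationNorm q (profile p d) := by
  have hq1 := one_le_toReal hq h1
  have hq0 : 0 < q.toReal := by positivity
  have hne : ENNReal.ofReal q.toReal ≠ 0 := by simpa using hq0
  rw [dilationNorm_of_ne_top hq, ← ENNReal.mul_rpow_of_nonneg _ _ (by positivity), one_div,
    ENNReal.le_rpow_inv_iff hq0, profile_rpow hq0]
  calc ENNReal.ofReal t ^ q.toReal * d t ^ (q.toReal / p)
      = ENNReal.ofReal q.toReal * (d t ^ (q.toReal / p) *
          (ENNReal.ofReal t ^ q.toReal / ENNReal.ofReal q.toReal)) := by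
        rw [mul_left_comm, ENNReal.mul_div_cancel hne ENNReal.ofReal_ne_top, mul_comm]
    _ = ENNReal.ofReal q.toReal * (d t ^ (q.toReal / p) *
          ∫⁻ s in Ioo (0 : ℝ) t, ENNReal.ofReal s ^ q.toReal / ENNReal.ofReal s) := by
        rw [lintegral_Ioo_rpow_div hq0 ht.le]
    _ ≤ ENNReal.ofReal q.toReal * ∫⁻ s in Ioo (0 : ℝ) t, d t ^ (q.toReal / p) *
          (ENNReal.ofReal s ^ q.toReal / ENNReal.ofReal s) := by
        gcongr
        exact lintegral_const_mul_le _ _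
    _ ≤ ENNReal.ofReal q.toReal * ∫⁻ s in Ioo (0 : ℝ) t,
          profile p d s ^ q.toReal / ENNReal.ofReal s := by
        refine mul_le_mul_right (setLIntegral_mono_ae' measurableSet_Ioo ?_) _
        filter_upwards with s hs
        rw [profile_rpow hq0, mul_comm, mul_comm (_ ^ _) (d s ^ _), mul_comm, mul_div_assoc]
        have := hd hs.2.le
        gcongr
    _ ≤ _ := by
        refine mul_le_mul_right (lintegral_mono_set fun s hs => hs.1) _

/-- The profile is bounded by its `q`-norm up to a constant, so in `φ^r = φ^{r-q} φ^q` the first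
factor can be taken out of the integral. -/
theorem exists_dilationNorm_le_of_le {p : ℝ} (hp : 0 < p) {q r : ℝ≥0∞} (h1 : 1 ≤ q)
    (hqr : q ≤ r) : ∃ C : ℝ≥0∞, C ≠ ∞ ∧ ∀ d : ℝ → ℝ≥0∞, Antitone d →
      dilationNorm r (profile p d) ≤ C * dilationNorm q (profile p d) := by
  rcases eq_or_ne q r with rfl | hne
  · exact ⟨1, by simp, fun d _ => by simp⟩
  have hlt : q < r := lt_of_le_of_ne hqr hne
  have hq : q ≠ ∞ := hlt.ne_top
  have hq1 := one_le_toReal hq h1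
  have hq0 : 0 < q.toReal := by positivity
  refine ⟨ENNReal.ofReal q.toReal ^ (1 / q.toReal), ENNReal.rpow_ne_top_of_nonneg (by positivity)
    ENNReal.ofReal_ne_top, fun d hd => ?_⟩
  set C := ENNReal.ofReal q.toReal ^ (1 / q.toReal) with hC
  have hsup := fun t ht => profile_le_dilationNorm hp hq h1 hd (t := t) ht
  rw [← hC] at hsup
  have hC1 : 1 ≤ C := by
    rw [hC]
    exact ENNReal.one_le_rpow (by simpa using hq1) (by positivity)
  have hC0 : C ≠ ∞ := ENNReal.rpow_ne_top_of_nonneg (by positivity) ENNReal.ofReal_ne_top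
  by_cases hr : r = ∞
  · subst hr
    rw [dilationNorm_top]
    exact iSup₂_le hsup
  set N := dilationNorm q (profile p d) with hN
  rcases eq_or_ne N ∞ with hNt | hNt
  · rw [hNt, ENNReal.mul_top (by positivity)]
    exact le_top
  have hr1 := one_le_toReal hr (h1.trans hqr)
  have hr0 : 0 < r.toReal := by positivity
  have hqr' : q.toReal < r.toReal := (ENNReal.toReal_lt_toReal hq hr).2 hlt
  rw [dilationNorm_of_ne_top hr, one_div, ENNReal.rpow_inv_le_iff hr0]
  have hsplit : ∀ x : ℝ≥0∞, x ^ r.toReal = x ^ (r.toReal - q.toReal) * x ^ q.toReal := by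
    intro x
    rw [← ENNReal.rpow_add_of_nonneg _ _ (by linarith) hq0.le, sub_add_cancel]
  calc ∫⁻ t in Ioi (0 : ℝ), profile p d t ^ r.toReal / ENNReal.ofReal t
      ≤ ∫⁻ t in Ioi (0 : ℝ), (C * N) ^ (r.toReal - q.toReal) *
          (profile p d t ^ q.toReal / ENNReal.ofReal t) := by
        refine setLIntegral_mono_ae' measurableSet_Ioi ?_
        filter_upwards with t ht
        rw [hsplit, mul_div_assoc]
        gcongr
        exact hsup t ht
    _ = (C * N) ^ (r.toReal - q.toReal) * N ^ q.toReal := by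
        rw [lintegral_const_mul' _ _ (ENNReal.rpow_ne_top_of_nonneg (by linarith)
          (ENNReal.mul_ne_top hC0 hNt)), hN, dilationNorm_rpow hq h1]
    _ ≤ (C * N) ^ (r.toReal - q.toReal) * (C * N) ^ q.toReal := by
        gcongr
        exact le_mul_of_one_le_left zero_le hC1
    _ = (C * N) ^ r.toReal := (hsplit _).symm

/-! ### Lorentz norms over distinct dyadic masses are weighted sequence norms. -/

/-- The `ℓ^q` norm of a family in `[0, ∞]`. -/
noncomputable def familyNorm {ι : Type*} (q : ℝ≥0∞) (a : ι → ℝ≥0∞) : ℝ≥0∞ :=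
  if q = ∞ then ⨆ i, a i else (∑' i, a i ^ q.toReal) ^ (1 / q.toReal)

/-- The distribution function of a function taking the value `c i` on a set of measure `m i`. -/
noncomputable def familyDist {ι : Type*} (m c : ι → ℝ≥0∞) (t : ℝ) : ℝ≥0∞ :=
  ∑' i, {j | ENNReal.ofReal t < c j}.indicator m i

theorem familyNorm_rpow {ι : Type*} {q : ℝ≥0∞} (hq : q ≠ ∞) (h1 : 1 ≤ q) (a : ι → ℝ≥0∞) :
    familyNorm q a ^ q.toReal = ∑' i, a i ^ q.toReal := by
  have := one_le_toReal hq h1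
  rw [familyNorm, if_neg hq, ← ENNReal.rpow_mul, one_div_mul_cancel (by positivity),
    ENNReal.rpow_one]

/-- The masses `2^{-e i}`. -/
noncomputable def dyadicMass {ι : Type*} (e : ι → ℕ) (i : ι) : ℝ≥0∞ := 2⁻¹ ^ e i

theorem dyadicMass_rpow {ι : Type*} (e : ι → ℕ) (s : ℝ) (i : ι) :
    dyadicMass e i ^ s = (2⁻¹ ^ s) ^ e i := by
  rw [dyadicMass, ← ENNReal.rpow_natCast, ← ENNReal.rpow_natCast, ← ENNReal.rpow_mul,
    ← ENNReal.rpow_mul, mul_comm]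

/-- Sums of powers of distinct dyadic masses are comparable to their largest term. -/
theorem exists_tsum_dyadicMass_le {ι : Type*} {e : ι → ℕ} (he : Function.Injective e) (s : ℝ)
    {S : Set ι} (hS : S.Nonempty) :
    ∃ i ∈ S, ∑' j, S.indicator (fun j => dyadicMass e j ^ s) j ≤
      (1 - 2⁻¹ ^ s)⁻¹ * dyadicMass e i ^ s := by
  refine ⟨Function.argminOn e S hS, Function.argminOn_mem e S hS, ?_⟩
  set i := Function.argminOn e S hS
  have hmin : ∀ j : S, e i ≤ e j := fun j => Function.argminOn_le e S j.2
  rw [← tsum_subtype S, dyadicMass_rpow, mul_comm, ← ENNReal.tsum_geometric]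
  calc ∑' j : S, dyadicMass e j ^ s
      = (2⁻¹ ^ s) ^ e i * ∑' j : S, (2⁻¹ ^ s) ^ (e j - e i) := by
        rw [← ENNReal.tsum_mul_left]
        refine tsum_congr fun j => ?_
        rw [dyadicMass_rpow, ← pow_add, Nat.add_sub_cancel' (hmin j)]
    _ ≤ _ := by
        gcongr
        -- Distinct exponents above the minimal one make the sum a subseries of the geometric
        -- series.
        refine ENNReal.tsum_comp_le_tsum_of_injective (f := fun j : S => e j - e i)
          (fun j k hjk => ?_) (fun n => (2⁻¹ ^ s) ^ n)
        have := hmin j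
        have := hmin k
        exact Subtype.ext (he (by dsimp only at hjk; omega))

theorem geomConst_ne_top {s : ℝ} (hs : 0 < s) : (1 - (2⁻¹ : ℝ≥0∞) ^ s)⁻¹ ≠ ∞ := by
  have : (2⁻¹ : ℝ≥0∞) ^ s < 1 := ENNReal.rpow_lt_one (by simp) hs
  simpa [tsub_eq_zero_iff_le] using this

theorem tsum_rpow_le_rpow_tsum {ι : Type*} {e : ι → ℕ} (he : Function.Injective e) {s : ℝ}
    (hs : 0 < s) (S : Set ι) :
    ∑' j, S.indicator (fun j => dyadicMass e j ^ s) j ≤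
      (1 - 2⁻¹ ^ s)⁻¹ * (∑' j, S.indicator (dyadicMass e) j) ^ s := by
  rcases S.eq_empty_or_nonempty with rfl | hS
  · simp
  obtain ⟨i, hi, h⟩ := exists_tsum_dyadicMass_le he s hS
  refine h.trans ?_
  gcongr
  simpa [hi] using ENNReal.le_tsum (f := S.indicator (dyadicMass e)) i

theorem rpow_tsum_le_tsum_rpow {ι : Type*} {e : ι → ℕ} (he : Function.Injective e) {s : ℝ}
    (hs : 0 < s) (S : Set ι) :
    (∑' j, S.indicator (dyadicMass e) j) ^ s ≤
      2 ^ s * ∑' j, S.indicator (fun j => dyadicMass e j ^ s) j := by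
  rcases S.eq_empty_or_nonempty with rfl | hS
  · simp [hs]
  obtain ⟨i, hi, h⟩ := exists_tsum_dyadicMass_le he 1 hS
  simp only [ENNReal.rpow_one, ENNReal.one_sub_inv_two, inv_inv] at h
  refine (ENNReal.rpow_le_rpow h hs.le).trans ?_
  rw [ENNReal.mul_rpow_of_nonneg _ _ hs.le]
  gcongr
  simpa [hi] using ENNReal.le_tsum (f := S.indicator (fun j => dyadicMass e j ^ s)) i

theorem setOf_pos_ofReal_lt {c : ℝ≥0∞} (hc : c ≠ ∞) :
    {t : ℝ | ENNReal.ofReal t < c} ∩ Ioi 0 = Ioo 0 c.toReal := by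
  ext t
  simp only [mem_inter_iff, mem_ofPred_eq, mem_Ioi, mem_Ioo, and_comm (b := 0 < t)]
  exact and_congr_right fun ht => ENNReal.ofReal_lt_iff_lt_toReal ht.le hc

/-- By Tonelli, each index contributes `M i` times the integral of `t^{q-1}` over `(0, c i)`. It is
applied with `M i = m i ^ (q/p)`, after the power `q/p` of a sum of distinct dyadic masses has been
exchanged with the sum of powers. -/
theorem lintegral_tsum_indicator_rpow {ι : Type*} [Countable ι] {q : ℝ} (hq : 0 < q)
    (M c : ι → ℝ≥0∞) (hc : ∀ i, c i ≠ ∞) :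
    ∫⁻ t in Ioi (0 : ℝ), ENNReal.ofReal t ^ q *
        (∑' i, {j | ENNReal.ofReal t < c j}.indicator M i) / ENNReal.ofReal t =
      (ENNReal.ofReal q)⁻¹ * ∑' i, c i ^ q * M i := by
  have hmeas : ∀ i, MeasurableSet {t : ℝ | ENNReal.ofReal t < c i} := fun i =>
    measurableSet_lt (by fun_prop) measurable_const
  have h1 : ∀ t : ℝ, ENNReal.ofReal t ^ q *
        (∑' i, {j | ENNReal.ofReal t < c j}.indicator M i) / ENNReal.ofReal t =
      ∑' i, {t : ℝ | ENNReal.ofReal t < c i}.indicator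
        (fun t => ENNReal.ofReal t ^ q / ENNReal.ofReal t * M i) t := by
    intro t
    rw [mul_comm, mul_div_assoc, mul_comm, ← ENNReal.tsum_mul_left]
    refine tsum_congr fun i => ?_
    by_cases h : ENNReal.ofReal t < c i <;> simp [h]
  simp_rw [h1]
  rw [lintegral_tsum fun i => (Measurable.indicator (by fun_prop) (hmeas i)).aemeasurable,
    ← ENNReal.tsum_mul_left]
  refine tsum_congr fun i => ?_
  rw [lintegral_indicator (hmeas i), Measure.restrict_restrict (hmeas i),
    setOf_pos_ofReal_lt (hc i), lintegral_mul_const _ (by fun_prop),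
    lintegral_Ioo_rpow_div hq ENNReal.toReal_nonneg, ENNReal.ofReal_toReal (hc i),
    div_eq_mul_inv]
  ring

theorem familyNorm_rpow_weighted {ι : Type*} {p : ℝ} {q : ℝ≥0∞} (hq : q ≠ ∞) (h1 : 1 ≤ q)
    (m c : ι → ℝ≥0∞) : familyNorm q (fun i => c i * m i ^ (1 / p)) ^ q.toReal =
      ∑' i, c i ^ q.toReal * m i ^ (q.toReal / p) := by
  rw [familyNorm_rpow hq h1]
  refine tsum_congr fun i => ?_
  rw [ENNReal.mul_rpow_of_nonneg _ _ ENNReal.toReal_nonneg, ← ENNReal.rpow_mul,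
    one_div_mul_eq_div]

theorem exists_dilationNorm_familyDist_le {p : ℝ} (hp : 0 < p) {q : ℝ≥0∞} (h1 : 1 ≤ q) :
    ∃ C : ℝ≥0∞, C ≠ ∞ ∧ ∀ {ι : Type} [Countable ι] {e : ι → ℕ}, Function.Injective e →
      ∀ c : ι → ℝ≥0∞, (∀ i, c i ≠ ∞) →
      dilationNorm q (profile p (familyDist (dyadicMass e) c)) ≤
        C * familyNorm q fun i => c i * dyadicMass e i ^ (1 / p) := by
  by_cases hq : q = ∞
  · subst hq
    refine ⟨2 ^ (1 / p), ENNReal.rpow_ne_top_of_nonneg (by positivity) (by simp),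
      fun {ι} _ e he c hc => ?_⟩
    rw [dilationNorm_top]
    refine iSup₂_le fun t ht => ?_
    rw [profile, familyDist]
    set S := {j | ENNReal.ofReal t < c j} with hSdef
    rcases S.eq_empty_or_nonempty with hS | hS
    · simp [hS, hp]
    obtain ⟨i, hi, h⟩ := exists_tsum_dyadicMass_le he 1 hS
    simp only [ENNReal.rpow_one, ENNReal.one_sub_inv_two, inv_inv] at h
    calc ENNReal.ofReal t * (∑' j, S.indicator (dyadicMass e) j) ^ (1 / p)
        ≤ c i * (2 * dyadicMass e i) ^ (1 / p) := by
          gcongr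
          exact le_of_lt hi
      _ = 2 ^ (1 / p) * (c i * dyadicMass e i ^ (1 / p)) := by
          rw [ENNReal.mul_rpow_of_nonneg _ _ (by positivity)]
          ring
      _ ≤ _ := by
          rw [familyNorm, if_pos rfl]
          gcongr
          exact le_iSup (fun i => c i * dyadicMass e i ^ (1 / p)) i
  · have hq1 := one_le_toReal hq h1
    have hq0 : 0 < q.toReal := by positivity
    have hs : 0 < q.toReal / p := by positivity
    refine ⟨(2 ^ (q.toReal / p) * (ENNReal.ofReal q.toReal)⁻¹) ^ (1 / q.toReal),
      ENNReal.rpow_ne_top_of_nonneg (by positivity) (ENNReal.mul_ne_top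
        (ENNReal.rpow_ne_top_of_nonneg (by positivity) (by simp)) (by simpa using hq0)),
      fun {ι} _ e he c hc => ?_⟩
    rw [← ENNReal.rpow_le_rpow_iff hq0, dilationNorm_rpow hq h1,
      ENNReal.mul_rpow_of_nonneg _ _ hq0.le, ← ENNReal.rpow_mul, one_div_mul_cancel hq0.ne',
      ENNReal.rpow_one, familyNorm_rpow_weighted hq h1, mul_assoc,
      ← lintegral_tsum_indicator_rpow hq0 _ _ hc, ← lintegral_const_mul' _ _
        (ENNReal.rpow_ne_top_of_nonneg (by positivity) (by simp))]
    refine lintegral_mono fun t => ?_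
    rw [profile_rpow hq0, mul_div_assoc, mul_div_assoc, ← mul_assoc, mul_comm (2 ^ _), mul_assoc,
      ← mul_div_assoc (2 ^ _)]
    gcongr
    exact rpow_tsum_le_tsum_rpow he hs _

theorem exists_familyNorm_le_dilationNorm {p : ℝ} (hp : 0 < p) {q : ℝ≥0∞} (h1 : 1 ≤ q) :
    ∃ C : ℝ≥0∞, C ≠ ∞ ∧ ∀ {ι : Type} [Countable ι] {e : ι → ℕ}, Function.Injective e →
      ∀ c : ι → ℝ≥0∞, (∀ i, c i ≠ ∞) →
      familyNorm q (fun i => c i * dyadicMass e i ^ (1 / p)) ≤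
        C * dilationNorm q (profile p (familyDist (dyadicMass e) c)) := by
  by_cases hq : q = ∞
  · subst hq
    refine ⟨1, by simp, fun {ι} _ e he c hc => ?_⟩
    rw [familyNorm, if_pos rfl, one_mul, dilationNorm_top]
    refine iSup_le fun i => ?_
    rw [mul_comm]
    -- The superlevel set at height `c i` itself misses `i`, so the value is approached by heights
    -- `b < c i`.
    refine ENNReal.mul_le_of_forall_lt fun a ha b hb => ?_
    have hbt : b ≠ ∞ := hb.ne_top
    rcases eq_or_ne b 0 with rfl | hb0
    · simp
    refine le_iSup₂_of_le b.toReal (ENNReal.toReal_pos hb0 hbt) ?_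
    rw [profile, ENNReal.ofReal_toReal hbt, mul_comm]
    gcongr
    refine ha.le.trans ?_
    gcongr
    have hi : i ∈ {j | ENNReal.ofReal b.toReal < c j} := by
      simpa [ENNReal.ofReal_toReal hbt] using hb
    simpa [hi, familyDist] using ENNReal.le_tsum
      (f := {j | ENNReal.ofReal b.toReal < c j}.indicator (dyadicMass e)) i
  · have hq1 := one_le_toReal hq h1
    have hq0 : 0 < q.toReal := by positivity
    have hs : 0 < q.toReal / p := by positivity
    have hne : ENNReal.ofReal q.toReal ≠ 0 := by simpa using hq0
    have hG := geomConst_ne_top hs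
    refine ⟨(ENNReal.ofReal q.toReal * (1 - 2⁻¹ ^ (q.toReal / p))⁻¹) ^ (1 / q.toReal),
      ENNReal.rpow_ne_top_of_nonneg (by positivity) (ENNReal.mul_ne_top ENNReal.ofReal_ne_top hG),
      fun {ι} _ e he c hc => ?_⟩
    rw [← ENNReal.rpow_le_rpow_iff hq0, ENNReal.mul_rpow_of_nonneg _ _ hq0.le, ← ENNReal.rpow_mul,
      one_div_mul_cancel hq0.ne', ENNReal.rpow_one, familyNorm_rpow_weighted hq h1,
      dilationNorm_rpow hq h1, mul_assoc]
    calc ∑' i, c i ^ q.toReal * dyadicMass e i ^ (q.toReal / p)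
        = ENNReal.ofReal q.toReal * ((ENNReal.ofReal q.toReal)⁻¹ *
            ∑' i, c i ^ q.toReal * dyadicMass e i ^ (q.toReal / p)) := by
          rw [← mul_assoc, ENNReal.mul_inv_cancel hne ENNReal.ofReal_ne_top, one_mul]
      _ ≤ _ := by
          rw [← lintegral_tsum_indicator_rpow hq0 _ _ hc, ← lintegral_const_mul' _ _ hG]
          gcongr with t
          rw [profile_rpow hq0, mul_div_assoc, mul_div_assoc, ← mul_assoc _ (_ ^ _),
            mul_comm _ (ENNReal.ofReal t ^ _), mul_assoc, ← mul_div_assoc (1 - _)⁻¹]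
          gcongr
          exact tsum_rpow_le_rpow_tsum he hs _

/-! ### Interpolation between `L^1` and `L^∞`. -/

/-- The distribution function of `g`. -/
noncomputable def distrib {X : Type*} [MeasurableSpace X] (μ : Measure X) (g : X → ℝ≥0∞)
    (t : ℝ) : ℝ≥0∞ :=
  μ {x | ENNReal.ofReal t < g x}

theorem antitone_distrib {X : Type*} [MeasurableSpace X] (μ : Measure X) (g : X → ℝ≥0∞) :
    Antitone (distrib μ g) := fun _ _ hst =>
  measure_mono fun _ hx => (ENNReal.ofReal_le_ofReal hst).trans_lt hx

theorem rpow_tsum_le_tsum_rpow_of_le_one {s : ℝ} (h0 : 0 < s) (h1 : s ≤ 1) (a : ℕ → ℝ≥0∞) :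
    (∑' j, a j) ^ s ≤ ∑' j, a j ^ s := by
  have hfin : ∀ n, (∑ j ∈ Finset.range n, a j) ^ s ≤ ∑ j ∈ Finset.range n, a j ^ s := by
    intro n
    induction n with
    | zero => simp [h0]
    | succ n ih =>
      rw [Finset.sum_range_succ, Finset.sum_range_succ]
      exact (ENNReal.rpow_add_le_add_rpow _ _ h0.le h1).trans (add_le_add ih le_rfl)
  refine le_of_tendsto' (((ENNReal.continuous_rpow_const (y := s)).tendsto _).comp
    (ENNReal.summable (f := a)).hasSum.tendsto_sum_nat) fun n => ?_
  exact (hfin n).trans (ENNReal.sum_le_tsum _)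

theorem profile_mono {p : ℝ} (hp : 0 < p) {d d' : ℝ → ℝ≥0∞} {t : ℝ} (h : d t ≤ d' t) :
    profile p d t ≤ profile p d' t := by
  unfold profile
  gcongr

theorem ofReal_mul_rpow_eq_profile (p : ℝ) (d : ℝ → ℝ≥0∞) {a : ℝ} (ha : 0 < a) (t : ℝ) :
    ENNReal.ofReal t * d (a * t) ^ (1 / p) =
      (ENNReal.ofReal a)⁻¹ * profile p d (a * t) := by
  have h0 : ENNReal.ofReal a ≠ 0 := by simpa using ha
  rw [profile, ENNReal.ofReal_mul ha.le, mul_assoc, ← mul_assoc,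
    ENNReal.inv_mul_cancel h0 ENNReal.ofReal_ne_top, one_mul]

theorem dilationNorm_profile_add_le {p : ℝ} (hp : 1 ≤ p) {q : ℝ≥0∞} (hq : 1 ≤ q)
    {d d₁ d₂ : ℝ → ℝ≥0∞} (hd₁ : Antitone d₁) (hd₂ : Antitone d₂)
    (h : ∀ t, 0 < t → d t ≤ d₁ (2⁻¹ * t) + d₂ (2⁻¹ * t)) :
    dilationNorm q (profile p d) ≤
      2 * (dilationNorm q (profile p d₁) + dilationNorm q (profile p d₂)) := by
  have hp0 : 0 < p := by positivity
  have hh : (0 : ℝ) < 2⁻¹ := by norm_num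
  have h2 : (ENNReal.ofReal 2⁻¹)⁻¹ = 2 := by
    rw [ENNReal.ofReal_inv_of_pos two_pos]; simp
  have hpt : ∀ t, 0 < t →
      profile p d t ≤ 2 * (profile p d₁ (2⁻¹ * t) + profile p d₂ (2⁻¹ * t)) := by
    intro t ht
    calc profile p d t
        ≤ ENNReal.ofReal t * (d₁ (2⁻¹ * t) ^ (1 / p) + d₂ (2⁻¹ * t) ^ (1 / p)) := by
          unfold profile
          gcongr
          refine (ENNReal.rpow_le_rpow (h t ht) (by positivity)).trans ?_
          exact ENNReal.rpow_add_le_add_rpow _ _ (by positivity) ((div_le_one hp0).2 hp)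
      _ = _ := by
          rw [mul_add, ofReal_mul_rpow_eq_profile p d₁ hh, ofReal_mul_rpow_eq_profile p d₂ hh, h2,
            mul_add]
  refine (dilationNorm_mono q hpt).trans ?_
  rw [dilationNorm_const_mul hq (by simp)]
  gcongr
  refine (dilationNorm_add_le hq ?_ ?_).trans (le_of_eq ?_)
  · exact (measurable_profile hd₁).comp (measurable_const_mul _)
  · exact (measurable_profile hd₂).comp (measurable_const_mul _)
  · rw [dilationNorm_comp_mul_left q _ hh, dilationNorm_comp_mul_left q _ hh]

/-- As `1/p ≤ 1`, the power `1/p` is subadditive. Minkowski then applies to the profiles, and each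
dilation by `a j` costs only the factor `1 / a j`, because `dt/t` is dilation invariant. -/
theorem dilationNorm_profile_le_of_le_tsum {p : ℝ} (hp : 1 ≤ p) {q : ℝ≥0∞} (hq : 1 ≤ q)
    {d d' : ℝ → ℝ≥0∞} (hd' : Antitone d') {w : ℕ → ℝ≥0∞} {a : ℕ → ℝ} (hw : ∀ j, w j ≠ ∞)
    (ha : ∀ j, 0 < a j) (h : ∀ t, 0 < t → d t ≤ ∑' j, w j * d' (a j * t)) :
    dilationNorm q (profile p d) ≤
      (∑' j, w j ^ (1 / p) * (ENNReal.ofReal (a j))⁻¹) * dilationNorm q (profile p d') := by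
  have hp0 : 0 < p := by positivity
  have hpt : ∀ t, 0 < t → profile p d t ≤
      ∑' j, w j ^ (1 / p) * (ENNReal.ofReal (a j))⁻¹ * profile p d' (a j * t) := by
    intro t ht
    calc profile p d t
        ≤ ENNReal.ofReal t * ∑' j, (w j * d' (a j * t)) ^ (1 / p) := by
          unfold profile
          gcongr
          refine (ENNReal.rpow_le_rpow (h t ht) (by positivity)).trans ?_
          exact rpow_tsum_le_tsum_rpow_of_le_one (by positivity) ((div_le_one hp0).2 hp) _
      _ = _ := by
          rw [← ENNReal.tsum_mul_left]
          refine tsum_congr fun j => ?_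
          rw [ENNReal.mul_rpow_of_nonneg _ _ (by positivity), mul_left_comm,
            ofReal_mul_rpow_eq_profile p d' (ha j), mul_assoc]
  refine (dilationNorm_mono q hpt).trans ?_
  have hm : ∀ j, Measurable fun t => profile p d' (a j * t) := fun j =>
    (measurable_profile hd').comp (measurable_const_mul _)
  refine (dilationNorm_tsum_le hq fun j => (hm j).const_mul _).trans (le_of_eq ?_)
  rw [← ENNReal.tsum_mul_right]
  refine tsum_congr fun j => ?_
  rw [dilationNorm_const_mul hq, dilationNorm_comp_mul_left q _ (ha j)]
  refine ENNReal.mul_ne_top (ENNReal.rpow_ne_top_of_nonneg (by positivity) (hw j)) ?_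
  simpa using ha j

theorem indicator_le_tsum_dyadic {τ : ℝ} (hτ : 0 < τ) {y : ℝ≥0∞} (hy : y ≠ ∞)
    (h : ENNReal.ofReal τ < y) :
    y ≤ ∑' j : ℕ, if ENNReal.ofReal (2 ^ j * τ) < y then ENNReal.ofReal (2 ^ (j + 1) * τ) else 0 := by
  lift y to ℝ≥0 using hy
  have hy' : ∀ a : ℝ, 0 ≤ a → (ENNReal.ofReal a < y ↔ a < y) := fun a ha => by
    rw [ENNReal.ofReal_lt_iff_lt_toReal ha (by simp)]; simp
  have hex : ∃ n : ℕ, (y : ℝ) ≤ 2 ^ n * τ := by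
    obtain ⟨n, hn⟩ := pow_unbounded_of_one_lt ((y : ℝ) / τ) (one_lt_two)
    exact ⟨n, ((div_lt_iff₀ hτ).1 hn).le⟩
  classical
  obtain ⟨j, hj⟩ : ∃ j, Nat.find hex = j + 1 := by
    refine Nat.exists_eq_succ_of_ne_zero fun h0 => ?_
    have := Nat.find_spec hex
    rw [h0, pow_zero, one_mul] at this
    exact absurd ((hy' τ hτ.le).1 h) (not_lt.2 this)
  have hlt : 2 ^ j * τ < y := not_le.1 (Nat.find_min hex (by omega))
  have hle : (y : ℝ) ≤ 2 ^ (j + 1) * τ := hj ▸ Nat.find_spec hex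
  -- The single term with `2^j τ < y ≤ 2^{j+1} τ` already dominates `y`.
  refine le_trans ?_ (ENNReal.le_tsum j)
  rw [if_pos ((hy' _ (by positivity)).2 hlt)]
  rw [← ENNReal.ofReal_coe_nnreal]
  exact ENNReal.ofReal_le_ofReal hle

/-- A subadditive operator bounded on `L¹` and on `L^∞`. -/
structure IsBoundedAveraging {X : Type*} [MeasurableSpace X] (μ : Measure X)
    (T : (X → ℝ≥0∞) → X → ℝ≥0∞) (A : ℝ≥0∞) (B : ℝ) : Prop where
  pos : 0 < B
  ne_top : A ≠ ∞
  add_le : ∀ f g x, T (f + g) x ≤ T f x + T g x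
  lintegral_le : ∀ f, ∫⁻ x, T f x ∂μ ≤ A * ∫⁻ x, f x ∂μ
  le_of_le : ∀ f c, (∀ x, f x ≤ c) → ∀ x, T f x ≤ ENNReal.ofReal B * c

/-- Split `f` at the height `τ = t / (2B)`. The low part maps below `t/2` by the `L^∞` bound; the
high part is handled by Chebyshev and the `L^1` bound, with its integral sliced at the heights `2^j
τ`. The coefficient is `(2/t) · A · 2^{j+1} τ = A (2/B) 2^j`. -/
theorem IsBoundedAveraging.distrib_le {X : Type*} [MeasurableSpace X] [DiscreteMeasurableSpace X]
    {μ : Measure X} {T : (X → ℝ≥0∞) → X → ℝ≥0∞} {A : ℝ≥0∞} {B : ℝ}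
    (hT : IsBoundedAveraging μ T A B) {f : X → ℝ≥0∞} (hf : ∀ x, f x ≠ ∞) {t : ℝ} (ht : 0 < t) :
    distrib μ (T f) t ≤
      ∑' j : ℕ, A * ENNReal.ofReal (2 / B) * 2 ^ j * distrib μ f (2 ^ j * (2 * B)⁻¹ * t) := by
  have hB := hT.pos
  set τ : ℝ := (2 * B)⁻¹ * t with hτ
  have hτ0 : 0 < τ := by positivity
  set S := {x | ENNReal.ofReal τ < f x} with hS
  set f₁ := S.indicator f with hf₁
  set f₂ := Sᶜ.indicator f with hf₂
  have hsum : f = f₁ + f₂ := (indicator_self_add_compl S f).symm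
  have hf₂le : ∀ x, f₂ x ≤ ENNReal.ofReal τ := by
    intro x
    by_cases hx : x ∈ S
    · simp [hf₂, hx]
    · simpa [hf₂, hx] using not_lt.1 hx
  have hT₂ : ∀ x, T f₂ x ≤ ENNReal.ofReal (t / 2) := by
    intro x
    refine (hT.le_of_le f₂ _ hf₂le x).trans (le_of_eq ?_)
    rw [← ENNReal.ofReal_mul hB.le, hτ]
    congr 1
    field_simp
  have hsub : {x | ENNReal.ofReal t < T f x} ⊆ {x | ENNReal.ofReal (t / 2) ≤ T f₁ x} := by
    intro x hx
    by_contra hcon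
    have hcon : T f₁ x < ENNReal.ofReal (t / 2) := not_le.1 hcon
    have h1 : T f x ≤ T f₁ x + T f₂ x := by
      conv_lhs => rw [hsum]
      exact hT.add_le f₁ f₂ x
    have h2 : T f₁ x + T f₂ x ≤ ENNReal.ofReal (t / 2) + ENNReal.ofReal (t / 2) :=
      add_le_add hcon.le (hT₂ x)
    rw [← ENNReal.ofReal_add (by positivity) (by positivity), add_halves] at h2
    exact absurd hx (not_lt.2 (h1.trans h2))
  have hf₁int : ∫⁻ x, f₁ x ∂μ ≤
      ∑' j : ℕ, ENNReal.ofReal (2 ^ (j + 1) * τ) * distrib μ f (2 ^ j * τ) := by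
    calc ∫⁻ x, f₁ x ∂μ
        ≤ ∫⁻ x, ∑' j : ℕ, {x | ENNReal.ofReal (2 ^ j * τ) < f x}.indicator
            (fun _ => ENNReal.ofReal (2 ^ (j + 1) * τ)) x ∂μ := by
          refine lintegral_mono fun x => ?_
          by_cases hx : x ∈ S
          · simpa [hf₁, hx, indicator_apply] using indicator_le_tsum_dyadic hτ0 (hf x) hx
          · simp [hf₁, hx]
      _ = _ := by
          rw [lintegral_tsum fun j => (Measurable.of_discrete).aemeasurable]
          refine tsum_congr fun j => ?_
          rw [lintegral_indicator_const (MeasurableSet.of_discrete), distrib]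
  have ht2 : ENNReal.ofReal (t / 2) ≠ 0 := by simpa using ht
  calc distrib μ (T f) t ≤ μ {x | ENNReal.ofReal (t / 2) ≤ T f₁ x} := measure_mono hsub
    _ = (ENNReal.ofReal (t / 2))⁻¹ *
          (ENNReal.ofReal (t / 2) * μ {x | ENNReal.ofReal (t / 2) ≤ T f₁ x}) := by
        rw [← mul_assoc, ENNReal.inv_mul_cancel ht2 ENNReal.ofReal_ne_top, one_mul]
    _ ≤ (ENNReal.ofReal (t / 2))⁻¹ * (A *
          ∑' j : ℕ, ENNReal.ofReal (2 ^ (j + 1) * τ) * distrib μ f (2 ^ j * τ)) := by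
        refine mul_le_mul_right ?_ _
        refine (mul_meas_ge_le_lintegral Measurable.of_discrete _).trans ?_
        exact (hT.lintegral_le f₁).trans (mul_le_mul_right hf₁int _)
    _ = _ := by
        rw [← mul_assoc, ← ENNReal.tsum_mul_left]
        refine tsum_congr fun j => ?_
        rw [← ENNReal.ofReal_inv_of_pos (by positivity), mul_comm _ A, mul_assoc, mul_assoc,
          mul_assoc]
        congr 1
        rw [← mul_assoc, ← mul_assoc, ← ENNReal.ofReal_mul (by positivity),
          show (2 : ℝ≥0∞) ^ j = ENNReal.ofReal (2 ^ j) by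
            rw [ENNReal.ofReal_pow (by norm_num)]; simp,
          ← mul_assoc (ENNReal.ofReal (2 / B)), ← ENNReal.ofReal_mul (by positivity),
          mul_assoc (2 ^ j) _ t, ← hτ]
        congr 2
        rw [pow_succ]
        field_simp

theorem IsBoundedAveraging.exists_dilationNorm_le {X : Type*} [MeasurableSpace X]
    [DiscreteMeasurableSpace X]
    {μ : Measure X} {T : (X → ℝ≥0∞) → X → ℝ≥0∞} {A : ℝ≥0∞} {B : ℝ}
    (hT : IsBoundedAveraging μ T A B) {p : ℝ} (hp : 1 < p) {q : ℝ≥0∞} (hq : 1 ≤ q) :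
    ∃ C : ℝ≥0∞, C ≠ ∞ ∧ ∀ f : X → ℝ≥0∞, (∀ x, f x ≠ ∞) →
      dilationNorm q (profile p (distrib μ (T f))) ≤
        C * dilationNorm q (profile p (distrib μ f)) := by
  have hB := hT.pos
  have hp0 : 0 < p := by linarith
  have hA : A * ENNReal.ofReal (2 / B) ≠ ∞ := ENNReal.mul_ne_top hT.ne_top ENNReal.ofReal_ne_top
  refine ⟨_, ?_, fun f hf => dilationNorm_profile_le_of_le_tsum hp.le hq (antitone_distrib μ f)
    (w := fun j => A * ENNReal.ofReal (2 / B) * 2 ^ j) (a := fun j => 2 ^ j * (2 * B)⁻¹)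
    (fun j => ENNReal.mul_ne_top hA (by simp)) (fun j => by positivity)
    fun t ht => hT.distrib_le hf ht⟩
  -- Weight `2^{j/p}` against dilation `2^{-j}`: the series is geometric with ratio `2^{1/p-1}`, and
  -- this is where `p > 1` is needed.
  have hterm : ∀ j : ℕ, (A * ENNReal.ofReal (2 / B) * 2 ^ j) ^ (1 / p) *
      (ENNReal.ofReal (2 ^ j * (2 * B)⁻¹))⁻¹ =
      (A * ENNReal.ofReal (2 / B)) ^ (1 / p) * ENNReal.ofReal (2 * B) *
        ((2 : ℝ≥0∞) ^ (1 / p - 1)) ^ j := by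
    intro j
    have hpow : ((2 : ℝ≥0∞) ^ j) ^ (1 / p) = (2 ^ (1 / p)) ^ j := by
      rw [← ENNReal.rpow_natCast, ← ENNReal.rpow_natCast, ← ENNReal.rpow_mul, ← ENNReal.rpow_mul,
        mul_comm]
    rw [ENNReal.mul_rpow_of_nonneg _ _ (by positivity),
      ← ENNReal.ofReal_inv_of_pos (by positivity), mul_inv, inv_inv, mul_comm _ (2 * B),
      ENNReal.ofReal_mul (by positivity), ENNReal.ofReal_inv_of_pos (by positivity),
      ENNReal.ofReal_pow (by norm_num), ENNReal.ofReal_ofNat,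
      ENNReal.rpow_sub _ _ (by simp) (by simp), ENNReal.rpow_one, div_eq_mul_inv (_ ^ _), mul_pow,
      ENNReal.inv_pow, hpow]
    ring
  simp_rw [hterm]
  rw [ENNReal.tsum_mul_left, ENNReal.tsum_geometric]
  refine ENNReal.mul_ne_top (ENNReal.mul_ne_top (ENNReal.rpow_ne_top_of_nonneg (by positivity) hA)
    ENNReal.ofReal_ne_top) ?_
  have : (2 : ℝ≥0∞) ^ (1 / p - 1) < 1 :=
    ENNReal.rpow_lt_one_of_one_lt_of_neg (by norm_num) (by
      have := (div_lt_one hp0).2 hp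
      linarith)
  simpa [tsub_eq_zero_iff_le] using this

/-- Layer cake formula. It replaces interpolation at the endpoint `p = q = 1`, where the `L^1` bound
is used directly. -/
theorem dilationNorm_one_profile_one {X : Type*} [MeasurableSpace X] [DiscreteMeasurableSpace X]
    (μ : Measure X) [SFinite μ] (g : X → ℝ≥0∞) :
    dilationNorm 1 (profile 1 (distrib μ g)) = ∫⁻ x, g x ∂μ := by
  have hc : ∀ c : ℝ≥0∞,
      ∫⁻ t in Ioi (0 : ℝ), {t : ℝ | ENNReal.ofReal t < c}.indicator 1 t = c := by
    intro c
    have hm : MeasurableSet {t : ℝ | ENNReal.ofReal t < c} :=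
      measurableSet_lt (by fun_prop) measurable_const
    rw [lintegral_indicator_one hm, Measure.restrict_apply hm]
    rcases eq_or_ne c ∞ with rfl | hc
    · simp
    · rw [setOf_pos_ofReal_lt hc, Real.volume_Ioo, sub_zero, ENNReal.ofReal_toReal hc]
  have hmp : MeasurableSet {z : ℝ × X | ENNReal.ofReal z.1 < g z.2} :=
    measurableSet_lt (by fun_prop) ((Measurable.of_discrete (f := g)).comp measurable_snd)
  rw [dilationNorm_of_ne_top (by simp)]
  simp only [ENNReal.toReal_one, div_one, ENNReal.rpow_one]
  calc ∫⁻ t in Ioi (0 : ℝ), profile 1 (distrib μ g) t / ENNReal.ofReal t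
      = ∫⁻ t in Ioi (0 : ℝ), ∫⁻ x,
          {z : ℝ × X | ENNReal.ofReal z.1 < g z.2}.indicator 1 (t, x) ∂μ := by
        refine setLIntegral_congr_fun measurableSet_Ioi fun t ht => ?_
        have h0 : ENNReal.ofReal t ≠ 0 := by simpa using ht
        simp only [profile, div_one, ENNReal.rpow_one]
        rw [mul_comm, ENNReal.mul_div_cancel_right h0 ENNReal.ofReal_ne_top, distrib,
          ← lintegral_indicator_one MeasurableSet.of_discrete]
        rfl
    _ = ∫⁻ x, (∫⁻ t in Ioi (0 : ℝ),
          {z : ℝ × X | ENNReal.ofReal z.1 < g z.2}.indicator 1 (t, x)) ∂μ :=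
        lintegral_lintegral_swap (f := fun t x =>
          {z : ℝ × X | ENNReal.ofReal z.1 < g z.2}.indicator 1 (t, x))
          (Measurable.indicator measurable_one hmp).aemeasurable
    _ = ∫⁻ x, g x ∂μ := lintegral_congr fun x => hc (g x)

theorem IsBoundedAveraging.exists_dilationNorm_le_of_admissible {X : Type*} [MeasurableSpace X]
    [DiscreteMeasurableSpace X] {μ : Measure X} [SFinite μ]
    {T : (X → ℝ≥0∞) → X → ℝ≥0∞} {A : ℝ≥0∞} {B : ℝ} (hT : IsBoundedAveraging μ T A B) {p : ℝ}
    {q r : ℝ≥0∞} (h : Admissible p q r) :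
    ∃ C : ℝ≥0∞, C ≠ ∞ ∧ ∀ f : X → ℝ≥0∞, (∀ x, f x ≠ ∞) →
      dilationNorm r (profile p (distrib μ (T f))) ≤
        C * dilationNorm q (profile p (distrib μ f)) := by
  rcases h with ⟨rfl, rfl, hr⟩ | ⟨hp, hq, hqr⟩
  · obtain ⟨C, hC, h⟩ := exists_dilationNorm_le_of_le one_pos le_rfl hr
    refine ⟨C * A, ENNReal.mul_ne_top hC hT.ne_top, fun f hf => ?_⟩
    refine (h _ (antitone_distrib μ (T f))).trans ?_
    rw [dilationNorm_one_profile_one, dilationNorm_one_profile_one, mul_assoc]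
    gcongr
    exact hT.lintegral_le f
  · obtain ⟨C, hC, h⟩ := exists_dilationNorm_le_of_le (by linarith : 0 < p) hq hqr
    obtain ⟨C', hC', h'⟩ := hT.exists_dilationNorm_le hp hq
    refine ⟨C * C', ENNReal.mul_ne_top hC hC', fun f hf => ?_⟩
    refine (h _ (antitone_distrib μ (T f))).trans ?_
    rw [mul_assoc]
    gcongr
    exact h' f hf

/-! ### The underlying metric space of stars. -/

/-- Pairs `(n, k)` with `k ≤ n`: the `k`-th level of the `n`-th star. -/
abbrev Level := Σ n : ℕ, Fin (n + 1)

/-- The leaves; there are `2 ^ k` of them on the level `(n, k)`. -/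
abbrev Leaf := Σ i : Level, Fin (2 ^ (i.2 : ℕ))

/-- The points of the space: the hubs of the stars, their leaves, and an end point attached to
each leaf. -/
inductive StarPoint
  | hub (n : ℕ)
  | leaf (l : Leaf)
  | tip (l : Leaf)

namespace StarPoint

/-- Each leaf is adjacent to the hub of its star and to its tip. -/
def Adj : StarPoint → StarPoint → Prop
  | hub n, leaf l => l.1.1 = n
  | leaf l, hub n => l.1.1 = n
  | leaf l, tip l' => l = l'
  | tip l, leaf l' => l' = l
  | _, _ => False

theorem Adj.symm {x y : StarPoint} (h : Adj x y) : Adj y x := by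
  cases x <;> cases y <;> simp_all [Adj]

theorem adj_comm (x y : StarPoint) : Adj x y ↔ Adj y x := ⟨Adj.symm, Adj.symm⟩

open Classical in
-- Distinct points are at distance 1 or 2, and `2 ≤ 1 + 1` gives the triangle inequality for any
-- symmetric adjacency relation.
noncomputable instance : MetricSpace StarPoint where
  dist x y := if x = y then 0 else if Adj x y then 1 else 2
  dist_self x := by simp
  dist_comm x y := by simp only [eq_comm, adj_comm]
  dist_triangle x y z := by
    by_cases hxy : x = y
    · subst hxy; simp
    by_cases hyz : y = z
    · subst hyz; simp
    simp only [hxy, hyz, if_false]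
    split_ifs <;> norm_num
  eq_of_dist_eq_zero := by
    intro x y h
    by_contra hxy
    simp only [hxy, if_false] at h
    split_ifs at h <;> norm_num at h

open Classical in
theorem dist_def (x y : StarPoint) :
    dist x y = if x = y then 0 else if Adj x y then 1 else 2 := rfl

theorem dist_le_two (x y : StarPoint) : dist x y ≤ 2 := by
  rw [dist_def]
  split_ifs <;> norm_num

theorem ball_of_le_one {x : StarPoint} {s : ℝ} (h0 : 0 < s) (h1 : s ≤ 1) :
    Metric.ball x s = {x} := by
  ext y
  rw [Metric.mem_ball, dist_def, mem_singleton_iff]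
  split_ifs with h h'
  · simpa [h] using h0
  · simpa [h] using h1
  · simp only [h, iff_false, not_lt]; linarith

theorem ball_of_le_two {x : StarPoint} {s : ℝ} (h1 : 1 < s) (h2 : s ≤ 2) :
    Metric.ball x s = insert x {y | Adj x y} := by
  ext y
  rw [Metric.mem_ball, dist_def, mem_insert_iff, mem_ofPred_eq, adj_comm x]
  split_ifs with h h'
  · simp only [h, true_or, iff_true]; linarith
  · simpa [h, h'] using h1
  · simpa [h, h'] using h2

theorem ball_of_two_lt {x : StarPoint} {s : ℝ} (h : 2 < s) : Metric.ball x s = univ :=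
  eq_univ_of_forall fun y => (dist_le_two y x).trans_lt h

theorem ball_leaf (l : Leaf) :
    Metric.ball (leaf l) 2 = {leaf l, hub l.1.1, tip l} := by
  rw [ball_of_le_two one_lt_two le_rfl]
  ext y
  cases y <;> simp [Adj, eq_comm]

theorem ball_tip (l : Leaf) : Metric.ball (tip l) 2 = {tip l, leaf l} := by
  rw [ball_of_le_two one_lt_two le_rfl]
  ext y
  cases y <;> simp [Adj]

theorem pairwise_disjoint_ball_hub :
    Pairwise (Function.onFun Disjoint fun n => Metric.ball (hub n) 2) := by
  intro m n hmn
  rw [Function.onFun, Set.disjoint_left]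
  intro y hm hn
  rw [ball_of_le_two one_lt_two le_rfl] at hm hn
  cases y <;> simp_all [Adj]

instance : DiscreteTopology StarPoint := by
  refine discreteTopology_iff_isOpen_singleton.2 fun x => ?_
  rw [← ball_of_le_one (x := x) one_pos le_rfl]
  exact Metric.isOpen_ball

instance : MeasurableSpace StarPoint := ⊤

instance : DiscreteMeasurableSpace StarPoint := ⟨fun _ => trivial⟩

instance : BorelSpace StarPoint := ⟨borel_eq_top_of_discrete.symm⟩

/-- Splitting into hubs, leaves and tips. -/
def equivSum : ℕ ⊕ (Leaf ⊕ Leaf) ≃ StarPoint where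
  toFun := Sum.elim hub (Sum.elim leaf tip)
  invFun
    | hub n => Sum.inl n
    | leaf l => Sum.inr (Sum.inl l)
    | tip l => Sum.inr (Sum.inr l)
  left_inv x := by rcases x with n | l | l <;> rfl
  right_inv x := by cases x <;> rfl

instance : Countable StarPoint := equivSum.symm.injective.countable

theorem tsum_eq (F : StarPoint → ℝ≥0∞) :
    ∑' x, F x = ∑' n, F (hub n) + (∑' l, F (leaf l) + ∑' l, F (tip l)) := by
  rw [← equivSum.tsum_eq, Summable.tsum_sum ENNReal.summable ENNReal.summable,
    Summable.tsum_sum ENNReal.summable ENNReal.summable]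
  rfl

end StarPoint

open StarPoint

/-! ### The measure: finiteness, positivity of balls, failure of doubling. -/

/-- The parameters of the space: the star `n` has a hub of mass `2 ^ (-e n)`, leaves of the same
mass, and tips of mass `2 ^ (-e n) * D i` on level `i`. -/
structure StarData where
  e : ℕ → ℕ
  D : Level → ℝ≥0
  le_e : ∀ n, n ≤ e n
  injective : Function.Injective fun i : Level => e i.1 - i.2
  one_le : ∀ i, 1 ≤ D i
  summable : ∑' n, (2⁻¹ : ℝ≥0∞) ^ e n * (1 + ∑ k : Fin (n + 1), 2 ^ (k : ℕ) * (1 + D ⟨n, k⟩)) ≠ ∞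

namespace StarData

variable (P : StarData)

/-- The mass of the hub of the star `n`. -/
noncomputable def mass (n : ℕ) : ℝ≥0∞ := 2⁻¹ ^ P.e n

/-- The masses of the points. -/
noncomputable def weight : StarPoint → ℝ≥0∞
  | hub n => P.mass n
  | leaf l => P.mass l.1.1
  | tip l => P.mass l.1.1 * P.D l.1

/-- The measure on the space. -/
noncomputable def measure : Measure StarPoint := Measure.count.withDensity P.weight

theorem lintegral_eq (f : StarPoint → ℝ≥0∞) :
    ∫⁻ x, f x ∂P.measure = ∑' x, P.weight x * f x := by
  rw [measure, lintegral_withDensity_eq_lintegral_mul _ Measurable.of_discrete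
    Measurable.of_discrete, lintegral_count]
  rfl

theorem measure_singleton (x : StarPoint) : P.measure {x} = P.weight x := by
  rw [measure, withDensity_apply _ MeasurableSet.of_discrete, lintegral_singleton,
    Measure.count_singleton, mul_one]

theorem mass_ne_zero (n : ℕ) : P.mass n ≠ 0 := by simp [mass]

theorem mass_ne_top (n : ℕ) : P.mass n ≠ ∞ := ENNReal.pow_ne_top (by simp)

theorem D_ne_zero (i : Level) : (P.D i : ℝ≥0∞) ≠ 0 := by
  have := (one_pos.trans_le (P.one_le i)).ne'
  exact_mod_cast this

theorem weight_ne_zero (x : StarPoint) : P.weight x ≠ 0 := by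
  cases x
  · exact P.mass_ne_zero _
  · exact P.mass_ne_zero _
  · exact mul_ne_zero (P.mass_ne_zero _) (P.D_ne_zero _)

theorem weight_ne_top (x : StarPoint) : P.weight x ≠ ∞ := by
  cases x
  · exact P.mass_ne_top _
  · exact P.mass_ne_top _
  · exact ENNReal.mul_ne_top (P.mass_ne_top _) ENNReal.coe_ne_top

theorem measure_univ_ne_top : P.measure univ ≠ ∞ := by
  have h : P.measure univ = ∑' x, P.weight x := by
    rw [← lintegral_one, lintegral_eq]; simp
  have hlevel : ∀ F : Level → ℝ≥0∞, ∑' l : Leaf, F l.1 =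
      ∑' n, ∑ k : Fin (n + 1), 2 ^ (k : ℕ) * F ⟨n, k⟩ := by
    intro F
    rw [ENNReal.tsum_sigma', ENNReal.tsum_sigma']
    refine tsum_congr fun n => ?_
    rw [tsum_fintype]
    refine Finset.sum_congr rfl fun k _ => ?_
    rw [tsum_fintype]
    simp
  rw [h, tsum_eq]
  simp only [weight]
  rw [hlevel (fun i => P.mass i.1), hlevel (fun i => P.mass i.1 * P.D i), ← ENNReal.tsum_add,
    ← ENNReal.tsum_add]
  convert P.summable using 3 with n
  push_cast
  rw [mul_add, mul_one, Finset.mul_sum, ← Finset.sum_add_distrib, mass]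
  congr 1
  refine Finset.sum_congr rfl fun k _ => ?_
  ring

instance : IsFiniteMeasure P.measure := ⟨P.measure_univ_ne_top.lt_top⟩

theorem measure_ball_ne_zero (x : StarPoint) {s : ℝ} (hs : 0 < s) :
    P.measure (Metric.ball x s) ≠ 0 := by
  have h : P.measure {x} ≤ P.measure (Metric.ball x s) :=
    measure_mono (singleton_subset_iff.2 (Metric.mem_ball_self hs))
  rw [measure_singleton] at h
  exact fun h0 => P.weight_ne_zero x (le_zero_iff.1 (h0 ▸ h))

theorem isStandard : IsStandard P.measure where
  nonempty := ⟨hub 0⟩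
  bounded := Metric.isBounded_iff.2 ⟨2, fun x _ y _ => dist_le_two x y⟩
  finite := P.measure_univ_ne_top.lt_top
  ball_pos x _ hs := pos_iff_ne_zero.2 (P.measure_ball_ne_zero x hs)

/-- Two doublings lead from a hub alone to the whole space, while the masses of the hubs tend to 0.
-/
theorem not_isDoubling : ¬ IsDoubling P.measure := by
  rintro ⟨C, hC⟩
  have hbound : ∀ n, P.measure univ ≤ C * (C * P.mass n) := by
    intro n
    have h1 := hC (hub n) 1 one_pos
    have h2 := hC (hub n) 2 two_pos
    rw [ball_of_two_lt (by norm_num)] at h2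
    rw [ball_of_le_one one_pos le_rfl, measure_singleton, mul_one] at h1
    exact h2.trans (mul_le_mul_right h1 _)
  have hlim : Filter.Tendsto (fun n => (C : ℝ≥0∞) * (C * P.mass n)) Filter.atTop (nhds 0) := by
    have h0 : Filter.Tendsto P.mass Filter.atTop (nhds 0) := by
      refine tendsto_of_tendsto_of_tendsto_of_le_of_le tendsto_const_nhds
        (ENNReal.tendsto_pow_atTop_nhds_zero_of_lt_one (r := 2⁻¹) (by simp)) (fun _ => zero_le)
        fun n => ?_
      exact pow_le_pow_right_of_le_one' (by simp) (P.le_e n)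
    simpa using ENNReal.Tendsto.const_mul (ENNReal.Tendsto.const_mul h0
      (Or.inr (ENNReal.coe_ne_top (r := C)))) (Or.inr (ENNReal.coe_ne_top (r := C)))
  have hz : P.measure univ ≤ 0 := ge_of_tendsto' hlim hbound
  have := P.measure_ball_ne_zero (hub 0) (s := 3) (by norm_num)
  rw [ball_of_two_lt (by norm_num)] at this
  exact this (le_zero_iff.1 hz)

end StarData

/-! ### Elementary properties of sequence norms and distribution functions. -/

theorem familyNorm_mono {ι : Type*} (q : ℝ≥0∞) {a b : ι → ℝ≥0∞} (h : ∀ i, a i ≤ b i) :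
    familyNorm q a ≤ familyNorm q b := by
  unfold familyNorm
  split_ifs
  · exact iSup_mono h
  · gcongr with i
    exact h i

theorem familyNorm_const_mul {ι : Type*} {q : ℝ≥0∞} (h1 : 1 ≤ q) (c : ℝ≥0∞) (a : ι → ℝ≥0∞) :
    familyNorm q (fun i => c * a i) = c * familyNorm q a := by
  unfold familyNorm
  split_ifs with hq
  · rw [ENNReal.mul_iSup]
  · have := one_le_toReal hq h1
    simp_rw [ENNReal.mul_rpow_of_nonneg _ _ (zero_le_one.trans this)]
    rw [ENNReal.tsum_mul_left, ENNReal.mul_rpow_of_nonneg _ _ (by positivity), ← ENNReal.rpow_mul,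
      mul_one_div_cancel (by positivity), ENNReal.rpow_one]

theorem familyNorm_comp_le {ι κ : Type*} (q : ℝ≥0∞) {j : κ → ι} (hj : Function.Injective j)
    (a : ι → ℝ≥0∞) : familyNorm q (fun k => a (j k)) ≤ familyNorm q a := by
  unfold familyNorm
  split_ifs
  · exact iSup_comp_le a j
  · gcongr
    exact ENNReal.tsum_comp_le_tsum_of_injective hj fun i => a i ^ q.toReal

/-- This separates the hub factor `u`, indexed by stars, from the factors `b` along the levels of
one star, leaving a supremum over stars. -/
theorem familyNorm_sigma_le {ι : Type*} {κ : ι → Type*} {q : ℝ≥0∞} (h1 : 1 ≤ q) (u : ι → ℝ≥0∞)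
    (b : (i : ι) → κ i → ℝ≥0∞) :
    familyNorm q (fun i : Sigma κ => u i.1 * b i.1 i.2) ≤
      (⨆ i, familyNorm q (b i)) * familyNorm q u := by
  by_cases hq : q = ∞
  · subst hq
    simp only [familyNorm, if_true]
    refine iSup_le fun i => ?_
    rw [mul_comm]
    exact mul_le_mul' (le_trans (le_iSup (b i.1) i.2) (le_iSup (fun n => ⨆ k, b n k) i.1))
      (le_iSup u i.1)
  · have hq1 := one_le_toReal hq h1
    have hq0 : 0 < q.toReal := by positivity
    rw [← ENNReal.rpow_le_rpow_iff hq0, ENNReal.mul_rpow_of_nonneg _ _ hq0.le,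
      familyNorm_rpow hq h1, familyNorm_rpow hq h1, ENNReal.tsum_sigma', ← ENNReal.tsum_mul_left]
    refine ENNReal.tsum_le_tsum fun i => ?_
    simp_rw [ENNReal.mul_rpow_of_nonneg _ _ hq0.le]
    rw [ENNReal.tsum_mul_left, mul_comm, ← familyNorm_rpow hq h1 (b i)]
    gcongr
    exact le_iSup (fun i => familyNorm q (b i)) i

theorem familyNorm_single {ι : Type*} [DecidableEq ι] {q : ℝ≥0∞} (h1 : 1 ≤ q) (i : ι) (c : ℝ≥0∞) :
    familyNorm q (fun j => if j = i then c else 0) = c := by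
  unfold familyNorm
  split_ifs with hq
  · exact le_antisymm (iSup_le fun j => by dsimp only; split_ifs <;> simp)
      (le_iSup_of_le i (by simp))
  · have hq1 := one_le_toReal hq h1
    have hq0 : 0 < q.toReal := by positivity
    rw [tsum_eq_single i fun j hj => by simp [hj, hq0]]
    dsimp only
    rw [if_pos rfl, ← ENNReal.rpow_mul,
      mul_one_div_cancel hq0.ne', ENNReal.rpow_one]

theorem distrib_mono {X : Type*} [MeasurableSpace X] (μ : Measure X) {f g : X → ℝ≥0∞}
    (h : ∀ x, f x ≤ g x) (t : ℝ) : distrib μ f t ≤ distrib μ g t :=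
  measure_mono fun x hx => lt_of_lt_of_le hx (h x)

theorem distrib_add_le {X : Type*} [MeasurableSpace X] (μ : Measure X) (f g : X → ℝ≥0∞) {t : ℝ}
    (ht : 0 < t) :
    distrib μ (fun x => f x + g x) t ≤ distrib μ f (2⁻¹ * t) + distrib μ g (2⁻¹ * t) := by
  refine (measure_mono fun x hx => ?_).trans (measure_union_le _ _)
  by_contra hcon
  simp only [mem_union, mem_ofPred_eq, not_or, not_lt] at hcon hx
  have := add_le_add hcon.1 hcon.2
  rw [← ENNReal.ofReal_add (by positivity) (by positivity), ← add_mul] at this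
  norm_num at this
  exact absurd hx (not_lt.2 this)

theorem dilationNorm_profile_mono {p : ℝ} (hp : 0 < p) (q : ℝ≥0∞) {d d' : ℝ → ℝ≥0∞}
    (h : ∀ t, 0 < t → d t ≤ d' t) :
    dilationNorm q (profile p d) ≤ dilationNorm q (profile p d') :=
  dilationNorm_mono q fun t ht => profile_mono hp (h t ht)

/-! ### Pointwise control of the maximal function by averaging and transfer. -/

namespace StarPoint

/-- The function equal to `c n` at the hub of the star `n` and to `0` elsewhere. -/
def hubFun (c : ℕ → ℝ≥0∞) : StarPoint → ℝ≥0∞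
  | hub n => c n
  | leaf _ => 0
  | tip _ => 0

/-- The function equal to `c i` at the leaves on level `i` and to `0` elsewhere. -/
def levelFun (c : Level → ℝ≥0∞) : StarPoint → ℝ≥0∞
  | hub _ => 0
  | leaf l => c l.1
  | tip _ => 0

end StarPoint

namespace StarData

variable (P : StarData)

/-- The leaves on level `i` have total mass `2 ^ (-levelExp i)`. -/
def levelExp (i : Level) : ℕ := P.e i.1 - i.2

theorem dyadicMass_levelExp (i : Level) :
    dyadicMass P.levelExp i = 2 ^ (i.2 : ℕ) * P.mass i.1 := by
  -- Since `k ≤ n ≤ e n`, the natural subtraction in `levelExp` does not truncate.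
  have hle : (i.2 : ℕ) ≤ P.e i.1 := (Nat.lt_succ_iff.1 i.2.2).trans (P.le_e _)
  rw [dyadicMass, mass, levelExp]
  conv_rhs => rw [← Nat.sub_add_cancel hle, pow_add, mul_left_comm, ← mul_pow,
    ENNReal.mul_inv_cancel (by simp) (by simp), one_pow, mul_one]

theorem injective_e : Function.Injective P.e := by
  intro m n hmn
  have := P.injective (a₁ := ⟨m, 0⟩) (a₂ := ⟨n, 0⟩) (by simpa using hmn)
  exact congrArg Sigma.fst this

theorem measure_eq_tsum (S : Set StarPoint) :
    P.measure S = ∑' x, S.indicator P.weight x := by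
  rw [← lintegral_indicator_one MeasurableSet.of_discrete, lintegral_eq]
  refine tsum_congr fun x => ?_
  by_cases hx : x ∈ S <;> simp [hx]

theorem distrib_hubFun (c : ℕ → ℝ≥0∞) :
    distrib P.measure (hubFun c) = familyDist (dyadicMass P.e) c := by
  ext t
  rw [distrib, measure_eq_tsum, tsum_eq]
  simp [indicator_apply, hubFun, familyDist, weight, mass, dyadicMass]

theorem distrib_levelFun (c : Level → ℝ≥0∞) :
    distrib P.measure (levelFun c) = familyDist (dyadicMass P.levelExp) c := by
  ext t
  rw [distrib, measure_eq_tsum, tsum_eq, ENNReal.tsum_sigma']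
  simp only [indicator_apply, levelFun, mem_ofPred_eq, not_lt_zero, if_false, tsum_zero, zero_add,
    add_zero, weight, tsum_fintype, familyDist, dyadicMass_levelExp]
  refine tsum_congr fun i => ?_
  split_ifs <;> simp

/-- The mean of `f` over a set. -/
noncomputable def mean (f : StarPoint → ℝ≥0∞) (S : Set StarPoint) : ℝ≥0∞ :=
  (∫⁻ y in S, f y ∂P.measure) / P.measure S

theorem mean_le {f : StarPoint → ℝ≥0∞} {c : ℝ≥0∞} (h : ∀ x, f x ≤ c) (S : Set StarPoint) :
    P.mean f S ≤ c := by
  refine ENNReal.div_le_of_le_mul ?_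
  exact (lintegral_mono h).trans (by simp)

theorem mean_add (f g : StarPoint → ℝ≥0∞) (S : Set StarPoint) :
    P.mean (f + g) S = P.mean f S + P.mean g S := by
  rw [mean, mean, mean, ← ENNReal.add_div]
  congr 1
  exact lintegral_add_left Measurable.of_discrete _

theorem mean_mul_measure_le (f : StarPoint → ℝ≥0∞) (S : Set StarPoint) :
    P.measure S * P.mean f S ≤ ∫⁻ y in S, f y ∂P.measure := ENNReal.mul_div_le

theorem mean_singleton (f : StarPoint → ℝ≥0∞) (x : StarPoint) : P.mean f {x} = f x := by
  rw [mean, lintegral_singleton, measure_singleton,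
    ENNReal.mul_div_cancel_right (P.weight_ne_zero x) (P.weight_ne_top x)]

/-- A bound for the means over balls of radius `2`, without the contribution of the hubs at the
leaves. -/
noncomputable def localPart (f : StarPoint → ℝ≥0∞) : StarPoint → ℝ≥0∞
  | hub n => P.mean f (Metric.ball (hub n) 2)
  | leaf l => f (tip l)
  | tip l => f (leaf l) / P.D l.1

/-- A bound for the maximal function without the contribution of the hubs at the leaves. -/
noncomputable def averaging (f : StarPoint → ℝ≥0∞) (x : StarPoint) : ℝ≥0∞ :=
  f x + P.mean f univ + P.localPart f x

/-- The transfer of the values at the hubs to the leaves. -/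
noncomputable def transfer (f : StarPoint → ℝ≥0∞) : StarPoint → ℝ≥0∞ :=
  levelFun fun i => f (hub i.1) / P.D i

theorem div_D_le (a : ℝ≥0∞) (i : Level) : a / P.D i ≤ a :=
  ENNReal.div_le_of_le_mul (le_mul_of_one_le_right zero_le (by exact_mod_cast P.one_le i))

theorem localPart_le {f : StarPoint → ℝ≥0∞} {c : ℝ≥0∞} (h : ∀ x, f x ≤ c) (x : StarPoint) :
    P.localPart f x ≤ c := by
  cases x with
  | hub n => exact P.mean_le h _
  | leaf l => exact h _
  | tip l => exact (P.div_D_le _ _).trans (h _)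

theorem localPart_add (f g : StarPoint → ℝ≥0∞) (x : StarPoint) :
    P.localPart (f + g) x = P.localPart f x + P.localPart g x := by
  cases x with
  | hub n => exact P.mean_add f g _
  | leaf l => rfl
  | tip l => exact ENNReal.add_div

/-- The balls of radius 2 around hubs are disjoint, so their means cost at most one integral of `f`.
The exchange of leaf and tip values costs a second: a tip has `D` times the mass of its leaf, which
the division by `D` compensates in one direction and `D ≥ 1` covers in the other. -/
theorem lintegral_localPart_le (f : StarPoint → ℝ≥0∞) :
    ∫⁻ x, P.localPart f x ∂P.measure ≤ 2 * ∫⁻ x, f x ∂P.measure := by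
  have hhub : ∑' n, P.mass n * P.mean f (Metric.ball (hub n) 2) ≤ ∫⁻ x, f x ∂P.measure := by
    calc ∑' n, P.mass n * P.mean f (Metric.ball (hub n) 2)
        ≤ ∑' n, ∫⁻ y in Metric.ball (hub n) 2, f y ∂P.measure := by
          refine ENNReal.tsum_le_tsum fun n => le_trans ?_ (P.mean_mul_measure_le f _)
          gcongr
          have h : P.measure {hub n} ≤ P.measure (Metric.ball (hub n) 2) :=
            measure_mono (singleton_subset_iff.2 (Metric.mem_ball_self two_pos))
          rwa [measure_singleton] at h
      _ = ∫⁻ y in ⋃ n, Metric.ball (hub n) 2, f y ∂P.measure :=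
          (lintegral_iUnion (fun _ => MeasurableSet.of_discrete)
            pairwise_disjoint_ball_hub f).symm
      _ ≤ _ := setLIntegral_le_lintegral _ _
  have htip : ∀ l : Leaf, P.mass l.1.1 * P.D l.1 * (f (leaf l) / P.D l.1) =
      P.mass l.1.1 * f (leaf l) := by
    intro l
    rw [mul_assoc, ENNReal.mul_div_cancel (P.D_ne_zero _) ENNReal.coe_ne_top]
  rw [two_mul]
  conv_lhs => rw [lintegral_eq, tsum_eq]
  refine add_le_add hhub ?_
  rw [lintegral_eq, tsum_eq]
  simp only [weight, localPart, htip]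
  rw [add_comm]
  refine le_add_left (add_le_add le_rfl (ENNReal.tsum_le_tsum fun l => ?_))
  gcongr
  exact le_mul_of_one_le_right zero_le (by exact_mod_cast P.one_le _)

/-- The `L^1` constant is 1 for the identity, 1 for the global mean and 2 for the local part; the
`L^∞` constant counts the three terms. -/
theorem isBoundedAveraging : IsBoundedAveraging P.measure P.averaging 4 3 where
  pos := by norm_num
  ne_top := by simp
  add_le f g x := by
    simp only [averaging, mean_add, localPart_add, Pi.add_apply]
    apply le_of_eq
    ring
  lintegral_le f := by
    simp only [averaging]
    rw [lintegral_add_left Measurable.of_discrete, lintegral_add_left Measurable.of_discrete,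
      lintegral_const, mul_comm (P.mean f univ)]
    have h1 := P.mean_mul_measure_le f univ
    rw [setLIntegral_univ] at h1
    calc _ ≤ ∫⁻ x, f x ∂P.measure + ∫⁻ x, f x ∂P.measure + 2 * ∫⁻ x, f x ∂P.measure :=
          add_le_add (add_le_add le_rfl h1) (P.lintegral_localPart_le f)
      _ = _ := by ring
  le_of_le f c h x := by
    calc P.averaging f x ≤ c + c + c :=
          add_le_add (add_le_add (h x) (P.mean_le h _)) (P.localPart_le h x)
      _ = _ := by
          rw [ENNReal.ofReal_ofNat]
          ring

theorem measure_ball_leaf (l : Leaf) : P.measure (Metric.ball (leaf l) 2) =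
    P.mass l.1.1 + (P.mass l.1.1 + P.mass l.1.1 * P.D l.1) := by
  have := lintegral_insert (μ := P.measure) (a := leaf l) (s := {hub l.1.1, tip l}) (by simp)
    (fun _ => 1)
  rw [ball_leaf, ← setLIntegral_one, this, lintegral_insert (by simp), lintegral_singleton]
  simp [measure_singleton, weight]

/-- The ball has mass at least `m` and at least `m D`. The hub has mass only `m`, so its value
enters with weight at most `1/D`. -/
theorem mean_ball_leaf_le (f : StarPoint → ℝ≥0∞) (l : Leaf) :
    P.mean f (Metric.ball (leaf l) 2) ≤ f (leaf l) + f (tip l) + f (hub l.1.1) / P.D l.1 := by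
  refine ENNReal.div_le_of_le_mul ?_
  rw [measure_ball_leaf, ball_leaf, lintegral_insert (by simp), lintegral_insert (by simp),
    lintegral_singleton, measure_singleton, measure_singleton, measure_singleton]
  simp only [weight]
  set m := P.mass l.1.1
  set D : ℝ≥0∞ := ((P.D l.1 : ℝ≥0) : ℝ≥0∞) with hD
  calc f (leaf l) * m + (f (hub l.1.1) * m + f (tip l) * (m * D))
      = f (leaf l) * m + (f (hub l.1.1) / D * (m * D) + f (tip l) * (m * D)) := by
        rw [mul_comm m D, ← mul_assoc (_ / D),
          ENNReal.div_mul_cancel (P.D_ne_zero _) ENNReal.coe_ne_top]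
    _ ≤ (f (leaf l) + f (tip l) + f (hub l.1.1) / D) * m +
        (f (hub l.1.1) / D + f (tip l)) * (m * D) := by
        rw [add_mul (f (hub l.1.1) / D)]
        refine add_le_add (mul_le_mul' ?_ le_rfl) le_rfl
        rw [add_assoc]
        exact le_self_add
    _ ≤ (f (leaf l) + f (tip l) + f (hub l.1.1) / D) * m +
        (f (leaf l) + f (tip l) + f (hub l.1.1) / D) * (m * D) := by
        refine add_le_add le_rfl (mul_le_mul' ?_ le_rfl)
        rw [add_assoc, add_comm (f (tip l))]
        exact le_add_self
    _ ≤ _ := by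
        rw [← mul_add]
        gcongr
        exact le_add_self

theorem mean_ball_tip_le (f : StarPoint → ℝ≥0∞) (l : Leaf) :
    P.mean f (Metric.ball (tip l) 2) ≤ f (tip l) + f (leaf l) / P.D l.1 := by
  refine ENNReal.div_le_of_le_mul ?_
  have hm : P.measure (Metric.ball (tip l) 2) = P.mass l.1.1 * P.D l.1 + P.mass l.1.1 := by
    have := lintegral_insert (μ := P.measure) (a := tip l) (s := {leaf l}) (by simp)
      (fun _ => 1)
    rw [ball_tip, ← setLIntegral_one, this, lintegral_singleton]
    simp [measure_singleton, weight]
  rw [hm, ball_tip, lintegral_insert (by simp), lintegral_singleton, measure_singleton,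
    measure_singleton]
  simp only [weight]
  set m := P.mass l.1.1
  set D : ℝ≥0∞ := ((P.D l.1 : ℝ≥0) : ℝ≥0∞) with hD
  calc f (tip l) * (m * D) + f (leaf l) * m
      = (f (tip l) + f (leaf l) / D) * (m * D) := by
        rw [add_mul, mul_comm m D, ← mul_assoc (_ / D),
          ENNReal.div_mul_cancel (P.D_ne_zero _) ENNReal.coe_ne_top]
    _ ≤ _ := by
        gcongr
        exact le_self_add

theorem maximalFunction_le (f : StarPoint → ℂ) (x : StarPoint) :
    maximalFunction P.measure f x ≤
      P.averaging (fun y => ‖f y‖ₑ) x + P.transfer (fun y => ‖f y‖ₑ) x := by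
  set g : StarPoint → ℝ≥0∞ := fun y => ‖f y‖ₑ
  refine iSup₂_le fun s hs => ?_
  change P.mean g (Metric.ball x s) ≤ _
  rcases le_or_gt s 1 with h1 | h1
  · rw [ball_of_le_one hs h1, mean_singleton, averaging]
    simp only [add_assoc]
    exact le_self_add
  rcases le_or_gt s 2 with h2 | h2
  · rw [ball_of_le_two h1 h2, ← ball_of_le_two one_lt_two le_rfl]
    cases x with
    | hub n =>
      rw [averaging, localPart, add_assoc]
      exact le_add_left le_self_add
    | leaf l =>
      refine (P.mean_ball_leaf_le g l).trans ?_
      rw [averaging, localPart, transfer, levelFun]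
      gcongr
      exact le_self_add
    | tip l =>
      refine (P.mean_ball_tip_le g l).trans (le_trans ?_ le_self_add)
      rw [averaging, localPart]
      gcongr
      exact le_self_add
  · rw [ball_of_two_lt h2, averaging, add_assoc, add_assoc]
    exact le_add_left le_self_add

/-- Converse to the upper bound: the ball of radius 2 has mass at most `3 m D`, and the hub alone
contributes `m ‖f(hub)‖`. -/
theorem le_maximalFunction (f : StarPoint → ℂ) (l : Leaf) :
    3⁻¹ * (‖f (hub l.1.1)‖ₑ / P.D l.1) ≤ maximalFunction P.measure f (leaf l) := by
  refine le_trans ?_ (le_iSup₂ (f := fun (s : ℝ) (_ : 0 < s) =>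
    (∫⁻ y in Metric.ball (leaf l) s, ‖f y‖ₑ ∂P.measure) / P.measure (Metric.ball (leaf l) s))
    2 two_pos)
  have hm0 := P.measure_ball_ne_zero (leaf l) two_pos
  rw [ENNReal.le_div_iff_mul_le (Or.inl hm0) (Or.inl (measure_ne_top _ _)), measure_ball_leaf,
    ball_leaf]
  have hD : (1 : ℝ≥0∞) ≤ P.D l.1 := by exact_mod_cast P.one_le l.1
  set m := P.mass l.1.1 with hm
  set D : ℝ≥0∞ := ((P.D l.1 : ℝ≥0) : ℝ≥0∞) with hD'
  calc 3⁻¹ * (‖f (hub l.1.1)‖ₑ / D) * (m + (m + m * D))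
      ≤ 3⁻¹ * (‖f (hub l.1.1)‖ₑ / D) * (m * D + (m * D + m * D)) := by
        have : m ≤ m * D := le_mul_of_one_le_right zero_le hD
        gcongr
    _ = (3⁻¹ * 3) * (‖f (hub l.1.1)‖ₑ / D * D) * m := by ring
    _ = ‖f (hub l.1.1)‖ₑ * P.measure {hub l.1.1} := by
        rw [ENNReal.inv_mul_cancel (by simp) (by simp), one_mul, measure_singleton,
          ENNReal.div_mul_cancel (P.D_ne_zero _) ENNReal.coe_ne_top, weight]
    _ = ∫⁻ y in {hub l.1.1}, ‖f y‖ₑ ∂P.measure :=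
        (lintegral_singleton (fun y => ‖f y‖ₑ) _).symm
    _ ≤ _ := lintegral_mono_set (by simp)

end StarData

/-! ### Admissible triples, normalizing factors and existence of the parameters. -/

theorem Admissible.one_le_p {p : ℝ} {q r : ℝ≥0∞} (h : Admissible p q r) : 1 ≤ p := by
  rcases h with ⟨rfl, _, _⟩ | ⟨h, _, _⟩
  · exact le_rfl
  · exact h.le

theorem Admissible.one_le_q {p : ℝ} {q r : ℝ≥0∞} (h : Admissible p q r) : 1 ≤ q := by
  rcases h with ⟨_, rfl, _⟩ | ⟨_, h, _⟩
  · exact le_rfl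
  · exact h

theorem Admissible.le {p : ℝ} {q r : ℝ≥0∞} (h : Admissible p q r) : q ≤ r := by
  rcases h with ⟨_, rfl, h⟩ | ⟨_, _, h⟩ <;> exact h

theorem Admissible.of_le {p : ℝ} {q r r' : ℝ≥0∞} (h : Admissible p q r) (hr : q ≤ r') :
    Admissible p q r' := by
  rcases h with ⟨hp, rfl, _⟩ | ⟨hp, hq, _⟩
  · exact Or.inl ⟨hp, rfl, hr⟩
  · exact Or.inr ⟨hp, hq, hr⟩

theorem exists_lorentzNorm_eq {p : ℝ} (hp : 1 ≤ p) {q : ℝ≥0∞} (hq : 1 ≤ q) :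
    ∃ κ : ℝ≥0∞, 1 ≤ κ ∧ κ ≠ ∞ ∧ ∀ {X : Type} [MeasurableSpace X] (μ : Measure X)
      (g : X → ℝ≥0∞), lorentzNorm μ p q g = κ * dilationNorm q (profile p (distrib μ g)) := by
  refine ⟨_, ?_, ?_, fun μ g => lorentzNorm_eq μ p q g⟩
  · split_ifs with h
    · exact le_rfl
    · have := one_le_toReal h hq
      exact ENNReal.one_le_rpow (by simpa using hp) (by positivity)
  · split_ifs
    · simp
    · exact ENNReal.rpow_ne_top_of_nonneg (by positivity) ENNReal.ofReal_ne_top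

theorem exists_starData (D : Level → ℝ≥0) (hD : ∀ i, 1 ≤ D i) : ∃ P : StarData, P.D = D := by
  set S : ℕ → ℝ≥0 := fun n => 1 + ∑ k : Fin (n + 1), 2 ^ (k : ℕ) * (1 + D ⟨n, k⟩) with hS
  -- `2 ^ E n` exceeds the mass of star `n` relative to its hub, so that `e n ≥ n + E n` makes the
  -- total mass of the star at most `2^{-n}`.
  choose E hE using fun n => pow_unbounded_of_one_lt (S n) (one_lt_two (α := ℝ≥0))
  set e : ℕ → ℕ := fun n => ∑ j ∈ Finset.range (n + 1), (E j + j + j + 1) with he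
  have hstep : ∀ n, E n + n + n + 1 ≤ e n := fun n =>
    Finset.single_le_sum (f := fun j => E j + j + j + 1) (fun _ _ => Nat.zero_le _)
      (Finset.self_mem_range_succ n)
  -- The exponents of the levels of star `n` fill `[e n - n, e n]`; this gap makes these intervals
  -- disjoint for different stars.
  have hlt : ∀ m n, m < n → e m + n < e n := by
    intro m n hmn
    obtain ⟨n, rfl⟩ : ∃ n', n = n' + 1 := ⟨n - 1, by omega⟩
    have h1 : e m ≤ e n := Finset.sum_le_sum_of_subset (Finset.range_mono (by omega))
    have h2 : e (n + 1) = e n + (E (n + 1) + (n + 1) + (n + 1) + 1) := Finset.sum_range_succ _ _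
    omega
  refine ⟨⟨e, D, fun n => by have := hstep n; omega, ?_, hD, ?_⟩, rfl⟩
  · rintro ⟨m, a⟩ ⟨n, b⟩ hab
    dsimp only at hab
    have ha := a.2
    have hb := b.2
    have hm := hstep m
    have hn := hstep n
    rcases lt_trichotomy m n with h | rfl | h
    · have := hlt m n h
      omega
    · have : a = b := Fin.ext (by omega)
      rw [this]
    · have := hlt n m h
      omega
  · refine ne_top_of_le_ne_top (b := ∑' n, (2⁻¹ : ℝ≥0∞) ^ n) ?_ (ENNReal.tsum_le_tsum fun n => ?_)
    · rw [ENNReal.tsum_geometric]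
      simp
    · have hSn : (1 + (↑(∑ k : Fin (n + 1), 2 ^ (k : ℕ) * (1 + D ⟨n, k⟩)) : ℝ≥0∞)) ≤ 2 ^ E n := by
        have := (hE n).le
        rw [hS] at this
        exact_mod_cast this
      calc (2⁻¹ : ℝ≥0∞) ^ e n * (1 + ↑(∑ k : Fin (n + 1), 2 ^ (k : ℕ) * (1 + D ⟨n, k⟩)))
          ≤ 2⁻¹ ^ (n + E n) * 2 ^ E n := by
            refine mul_le_mul' (pow_le_pow_right_of_le_one' (by simp) ?_) hSn
            have := hstep n
            omega
        _ = 2⁻¹ ^ n := by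
            rw [pow_add, mul_assoc, ← mul_pow, ENNReal.inv_mul_cancel (by simp) (by simp), one_pow,
              mul_one]

/-! ### Boundedness of the maximal operator is equivalent to bounded star norms. -/

namespace StarData

variable (P : StarData)

/-- The `ℓ^r` norm which measures the size of the maximal function of the indicator of the hub of
the star `n`. -/
noncomputable def starNorm (p : ℝ) (r : ℝ≥0∞) (n : ℕ) : ℝ≥0∞ :=
  familyNorm r fun k : Fin (n + 1) => ((2 : ℝ≥0∞) ^ (k : ℕ)) ^ (1 / p) / P.D ⟨n, k⟩

theorem div_D_mul_dyadicMass_rpow {p : ℝ} (hp : 0 < p) (a : ℝ≥0∞) (i : Level) :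
    a / P.D i * dyadicMass P.levelExp i ^ (1 / p) =
      a * dyadicMass P.e i.1 ^ (1 / p) * (((2 : ℝ≥0∞) ^ (i.2 : ℕ)) ^ (1 / p) / P.D i) := by
  rw [dyadicMass_levelExp, ENNReal.mul_rpow_of_nonneg _ _ (by positivity)]
  simp only [div_eq_mul_inv, one_mul]
  change a * _ * (_ * P.mass i.1 ^ p⁻¹) = a * P.mass i.1 ^ p⁻¹ * _
  ring

/-- Pass to sequence norms over levels, factor out the hubs, and return to the Lorentz norm of the
restriction to the hubs. -/
theorem exists_transfer_le {p : ℝ} (hp : 0 < p) {r : ℝ≥0∞} (hr : 1 ≤ r)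
    (h : (⨆ n, P.starNorm p r n) ≠ ∞) :
    ∃ C : ℝ≥0∞, C ≠ ∞ ∧ ∀ g : StarPoint → ℝ≥0∞, (∀ x, g x ≠ ∞) →
      dilationNorm r (profile p (distrib P.measure (P.transfer g))) ≤
        C * dilationNorm r (profile p (distrib P.measure g)) := by
  obtain ⟨C₁, hC₁, h₁⟩ := exists_dilationNorm_familyDist_le hp hr
  obtain ⟨C₂, hC₂, h₂⟩ := exists_familyNorm_le_dilationNorm hp hr
  refine ⟨C₁ * ((⨆ n, P.starNorm p r n) * C₂),
    ENNReal.mul_ne_top hC₁ (ENNReal.mul_ne_top h hC₂), fun g hg => ?_⟩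
  rw [transfer, distrib_levelFun]
  refine (h₁ P.injective _ fun i => ENNReal.div_ne_top (hg _) (P.D_ne_zero i)).trans ?_
  rw [mul_assoc, mul_assoc]
  refine mul_le_mul_right ?_ _
  have hsigma := familyNorm_sigma_le hr (fun n => g (hub n) * dyadicMass P.e n ^ (1 / p))
    fun n (k : Fin (n + 1)) => ((2 : ℝ≥0∞) ^ (k : ℕ)) ^ (1 / p) / P.D ⟨n, k⟩
  refine (familyNorm_mono r fun i => (P.div_D_mul_dyadicMass_rpow hp _ i).le).trans
    (hsigma.trans (mul_le_mul_right ?_ _))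
  refine (h₂ P.injective_e (fun n => g (hub n)) fun n => hg _).trans (mul_le_mul_right ?_ _)
  rw [← distrib_hubFun]
  refine dilationNorm_profile_mono hp r fun t _ => distrib_mono _ (fun x => ?_) t
  cases x <;> simp [hubFun]

/-- The averaging part maps `L^{p,q}` to `L^{p,r}`. The transfer is bounded only within `L^{p,r}`,
so it is preceded by the embedding `L^{p,q} ⊆ L^{p,r}`. -/
theorem bestConstant_lt_top {p : ℝ} {q r : ℝ≥0∞} (hadm : Admissible p q r)
    (h : (⨆ n, P.starNorm p r n) ≠ ∞) : bestConstant P.measure p q r < ∞ := by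
  have hp1 := hadm.one_le_p
  have hp : 0 < p := by positivity
  have hq := hadm.one_le_q
  have hr := hq.trans hadm.le
  obtain ⟨κr, _, hκr, hLr⟩ := exists_lorentzNorm_eq hp1 hr
  obtain ⟨κq, hκq, _, hLq⟩ := exists_lorentzNorm_eq hp1 hq
  obtain ⟨C₁, hC₁, h₁⟩ := P.isBoundedAveraging.exists_dilationNorm_le_of_admissible hadm
  obtain ⟨C₂, hC₂, h₂⟩ := P.exists_transfer_le hp hr h
  obtain ⟨C₃, hC₃, h₃⟩ := exists_dilationNorm_le_of_le hp hq hadm.le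
  have hC : κr * (2 * (C₁ + C₂ * C₃)) ≠ ∞ := by finiteness
  refine lt_of_le_of_lt (iInf₂_le (κr * (2 * (C₁ + C₂ * C₃))).toNNReal fun f _ _ => ?_)
    ENNReal.coe_lt_top
  rw [ENNReal.coe_toNNReal hC, hLr, hLq]
  set g : StarPoint → ℝ≥0∞ := fun x => ‖f x‖ₑ
  have hg : ∀ x, g x ≠ ∞ := fun x => enorm_ne_top
  set N := dilationNorm q (profile p (distrib P.measure g))
  calc κr * dilationNorm r (profile p (distrib P.measure (maximalFunction P.measure f)))
      ≤ κr * dilationNorm r (profile p (distrib P.measure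
          fun x => P.averaging g x + P.transfer g x)) := by
        gcongr
        exact dilationNorm_profile_mono hp r fun t _ => distrib_mono _ (P.maximalFunction_le f) t
    _ ≤ κr * (2 * (C₁ * N + C₂ * (C₃ * N))) := by
        refine mul_le_mul_right ((dilationNorm_profile_add_le hp1 hr (antitone_distrib _ _)
          (antitone_distrib _ _) fun t ht => distrib_add_le _ _ _ ht).trans ?_) _
        refine mul_le_mul_right (add_le_add (h₁ g hg) ((h₂ g hg).trans ?_)) _
        exact mul_le_mul_right (h₃ _ (antitone_distrib _ _)) _
    _ = κr * (2 * (C₁ + C₂ * C₃)) * (1 * N) := by ring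
    _ ≤ _ := by gcongr

/-- Test on the indicator of a single hub: a finite constant would bound all star norms uniformly.
-/
theorem bestConstant_eq_top {p : ℝ} {q r : ℝ≥0∞} (hadm : Admissible p q r)
    (h : (⨆ n, P.starNorm p r n) = ∞) : bestConstant P.measure p q r = ∞ := by
  have hp1 := hadm.one_le_p
  have hp : 0 < p := by positivity
  have hq := hadm.one_le_q
  have hr := hq.trans hadm.le
  obtain ⟨κr, hκr, _, hLr⟩ := exists_lorentzNorm_eq hp1 hr
  obtain ⟨κq, _, hκq, hLq⟩ := exists_lorentzNorm_eq hp1 hq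
  obtain ⟨C₁, hC₁, h₁⟩ := exists_dilationNorm_familyDist_le hp hq
  obtain ⟨C₂, hC₂, h₂⟩ := exists_familyNorm_le_dilationNorm hp hr
  refine iInf₂_eq_top.2 fun c hc => ?_
  exfalso
  -- The 3 undoes the loss in `le_maximalFunction`. The factor `η = m_n^{1/p}` occurs on both sides
  -- and cancels, so the bound does not depend on `n`.
  refine ne_top_of_le_ne_top (b := 3 * (C₂ * (c * (κq * C₁)))) (by finiteness)
    (iSup_le fun n => ?_) h
  set f : StarPoint → ℂ := ({hub n} : Set StarPoint).indicator 1 with hf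
  set η : ℝ≥0∞ := dyadicMass P.e n ^ (1 / p) with hη
  have hη0 : η ≠ 0 := (ENNReal.rpow_pos (pos_iff_ne_zero.2 (P.mass_ne_zero n))
    (P.mass_ne_top n)).ne'
  have hηt : η ≠ ∞ := ENNReal.rpow_ne_top_of_nonneg (by positivity) (P.mass_ne_top n)
  have hfhub : (fun x => ‖f x‖ₑ) = hubFun fun m => if m = n then 1 else 0 := by
    ext x
    cases x with
    | hub m => by_cases hm : m = n <;> simp [hf, hubFun, hm]
    | leaf l => simp [hf, hubFun]
    | tip l => simp [hf, hubFun]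
  have hfnorm : lorentzNorm P.measure p q (fun x => ‖f x‖ₑ) ≤ κq * (C₁ * η) := by
    rw [hLq, hfhub, distrib_hubFun]
    refine mul_le_mul_right ((h₁ P.injective_e _ fun i => by split_ifs <;> simp).trans ?_) _
    refine mul_le_mul_right (le_of_eq ?_) _
    rw [← familyNorm_single hq n η]
    congr 1
    ext m
    by_cases hm : m = n <;> simp [hm, hη]
  have hfin : lorentzNorm P.measure p q (fun x => ‖f x‖ₑ) < ∞ :=
    hfnorm.trans_lt (by finiteness)
  set u : Level → ℝ≥0∞ := fun i => 3⁻¹ * ((if i.1 = n then 1 else 0) / P.D i) with hu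
  have hlower : familyNorm r (fun i => u i * dyadicMass P.levelExp i ^ (1 / p)) ≤
      C₂ * (c * (κq * (C₁ * η))) := by
    refine (h₂ P.injective u fun i => ?_).trans (mul_le_mul_right ?_ _)
    · refine ENNReal.mul_ne_top (by simp) (ENNReal.div_ne_top ?_ (P.D_ne_zero i))
      split_ifs <;> simp
    · calc dilationNorm r (profile p (familyDist (dyadicMass P.levelExp) u))
          ≤ 1 * dilationNorm r (profile p (distrib P.measure (maximalFunction P.measure f))) := by
            rw [one_mul, ← distrib_levelFun]
            refine dilationNorm_profile_mono hp r fun t _ => distrib_mono _ (fun x => ?_) t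
            cases x with
            | hub m => simp [levelFun]
            | leaf l =>
              refine le_trans (le_of_eq ?_) (P.le_maximalFunction f l)
              rw [congrFun hfhub (hub l.1.1)]
              rfl
            | tip l => simp [levelFun]
        _ ≤ lorentzNorm P.measure p r (maximalFunction P.measure f) := by
            rw [hLr]
            gcongr
        _ ≤ c * (κq * (C₁ * η)) :=
            (hc f Measurable.of_discrete hfin).trans (mul_le_mul_right hfnorm _)
  have hstar : 3⁻¹ * η * P.starNorm p r n ≤ C₂ * (c * (κq * (C₁ * η))) := by
    refine le_trans ?_ hlower
    rw [starNorm, ← familyNorm_const_mul hr]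
    refine le_trans (le_of_eq ?_) (familyNorm_comp_le r
      (j := fun k : Fin (n + 1) => (⟨n, k⟩ : Level)) (fun _ _ h => by simpa using h) _)
    congr 1
    ext k
    rw [hu]
    simp only [if_true]
    rw [mul_assoc 3⁻¹ (1 / _), P.div_D_mul_dyadicMass_rpow hp, one_mul, mul_assoc]
  calc P.starNorm p r n = 3 * (η⁻¹ * (3⁻¹ * η * P.starNorm p r n)) := by
        rw [show 3 * (η⁻¹ * (3⁻¹ * η * P.starNorm p r n)) =
          (3 * 3⁻¹) * (η⁻¹ * η) * P.starNorm p r n by ring, ENNReal.inv_mul_cancel hη0 hηt,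
          ENNReal.mul_inv_cancel (by simp) (by simp), one_mul, one_mul]
    _ ≤ 3 * (η⁻¹ * (C₂ * (c * (κq * (C₁ * η))))) := by gcongr
    _ = 3 * (C₂ * (c * (κq * C₁))) * (η⁻¹ * η) := by ring
    _ = 3 * (C₂ * (c * (κq * C₁))) := by rw [ENNReal.inv_mul_cancel hη0 hηt, mul_one]

end StarData

/-! ### Choice of the arrays. -/

/-- A space on which boundedness is decided by the `ℓ^r` norms of a prescribed triangular array. -/
theorem exists_space_of_array {p : ℝ} (hp : 1 ≤ p) (b : ℕ → ℕ → ℝ≥0) (hb0 : ∀ n k, b n k ≠ 0)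
    (hb : ∀ n k, (b n k : ℝ≥0∞) ≤ (2 ^ k : ℝ≥0∞) ^ (1 / p)) :
    ∃ (Z : Type) (_ : MetricSpace Z) (_ : MeasurableSpace Z) (_ : BorelSpace Z) (μ : Measure Z),
      IsStandard μ ∧ ¬ IsDoubling μ ∧ ∀ q r, Admissible p q r →
        (bestConstant μ p q r < ∞ ↔
          (⨆ n, familyNorm r fun k : Fin (n + 1) => (b n k : ℝ≥0∞)) ≠ ∞) := by
  have hp0 : 0 < p := by positivity
  have hpow : ∀ k : ℕ, (((2 : ℝ≥0) ^ k) ^ (1 / p) : ℝ≥0) = ((2 : ℝ≥0∞) ^ k) ^ (1 / p) := by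
    intro k
    rw [ENNReal.coe_rpow_of_nonneg _ (by positivity)]
    simp
  -- `D_{n,k} = 2^{k/p} / b_{n,k}` makes the star norms those of `b`; the upper bound on `b` is
  -- exactly `D ≥ 1`.
  obtain ⟨P, hP⟩ := exists_starData (fun i => (2 ^ (i.2 : ℕ)) ^ (1 / p) / b i.1 i.2) fun i => by
    rw [one_le_div (pos_iff_ne_zero.2 (hb0 _ _)), ← ENNReal.coe_le_coe, hpow]
    exact hb _ _
  have hstar : ∀ r n, P.starNorm p r n = familyNorm r fun k : Fin (n + 1) => (b n k : ℝ≥0∞) := by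
    intro r n
    rw [StarData.starNorm]
    congr 1
    ext k
    have h0 : ((2 : ℝ≥0) ^ (k : ℕ)) ^ (1 / p) ≠ 0 :=
      (NNReal.rpow_pos (by positivity)).ne'
    rw [hP, ← hpow, ← ENNReal.coe_div (div_ne_zero h0 (hb0 _ _)), div_div_cancel₀ h0]
  refine ⟨StarPoint, inferInstance, inferInstance, inferInstance, P.measure, P.isStandard,
    P.not_isDoubling, fun q r hadm => ?_⟩
  simp_rw [← hstar]
  refine ⟨fun h hcon => h.ne (P.bestConstant_eq_top hadm hcon), P.bestConstant_lt_top hadm⟩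

theorem le_familyNorm {ι : Type*} {q : ℝ≥0∞} (h1 : 1 ≤ q) (a : ι → ℝ≥0∞) (i : ι) :
    a i ≤ familyNorm q a := by
  by_cases hq : q = ∞
  · rw [familyNorm, if_pos hq]
    exact le_iSup a i
  · have := one_le_toReal hq h1
    rw [← ENNReal.rpow_le_rpow_iff (by positivity : 0 < q.toReal), familyNorm_rpow hq h1]
    exact ENNReal.le_tsum (f := fun i => a i ^ q.toReal) i

theorem familyNorm_top_le {ι : Type*} {a : ι → ℝ≥0∞} {c : ℝ≥0∞} (h : ∀ i, a i ≤ c) :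
    familyNorm ∞ a ≤ c := by
  rw [familyNorm, if_pos rfl]
  exact iSup_le h

theorem familyNorm_fin_const {q : ℝ≥0∞} (hq : q ≠ ∞) (h1 : 1 ≤ q) (n : ℕ) (c : ℝ≥0∞) :
    familyNorm q (fun _ : Fin n => c) = (n : ℝ≥0∞) ^ (1 / q.toReal) * c := by
  have := one_le_toReal hq h1
  rw [familyNorm, if_neg hq, tsum_fintype]
  simp only [Finset.sum_const, Finset.card_univ, Fintype.card_fin, nsmul_eq_mul]
  rw [ENNReal.mul_rpow_of_nonneg _ _ (by positivity), ← ENNReal.rpow_mul,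
    mul_one_div_cancel (by positivity), ENNReal.rpow_one]

/-- When the rows are initial segments of one sequence, their norms increase to its full `ℓ^q` norm.
-/
theorem iSup_familyNorm_fin_ne_top_iff {q : ℝ≥0∞} (hq : q ≠ ∞) (h1 : 1 ≤ q) (a : ℕ → ℝ≥0∞) :
    (⨆ n, familyNorm q fun k : Fin (n + 1) => a k) ≠ ∞ ↔ ∑' k, a k ^ q.toReal ≠ ∞ := by
  have hq1 := one_le_toReal hq h1
  constructor
  · intro h
    refine ne_top_of_le_ne_top (ENNReal.rpow_ne_top_of_nonneg (y := q.toReal) (by positivity) h) ?_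
    rw [ENNReal.tsum_eq_iSup_nat]
    refine iSup_le fun n => ?_
    calc ∑ k ∈ Finset.range n, a k ^ q.toReal
        ≤ ∑ k ∈ Finset.range (n + 1), a k ^ q.toReal :=
          Finset.sum_le_sum_of_subset (Finset.range_mono (Nat.le_succ n))
      _ = familyNorm q (fun k : Fin (n + 1) => a k) ^ q.toReal := by
          rw [familyNorm_rpow hq h1, tsum_fintype,
            Fin.sum_univ_eq_sum_range (fun k => a k ^ q.toReal)]
      _ ≤ _ := by
          gcongr
          exact le_iSup (fun n => familyNorm q fun k : Fin (n + 1) => a k) n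
  · intro h
    rw [← familyNorm_rpow hq h1] at h
    have h' : familyNorm q a ≠ ∞ := fun hcon => h (by
      rw [hcon, ENNReal.top_rpow_of_pos (by positivity)])
    exact ne_top_of_le_ne_top h'
      (iSup_le fun n => familyNorm_comp_le q Fin.val_injective a)

theorem iSup_natCast_rpow_eq_top {s : ℝ} (hs : 0 < s) :
    ⨆ n : ℕ, ((n + 1 : ℕ) : ℝ≥0∞) ^ s = ∞ := by
  have h : Filter.Tendsto (fun n : ℕ => ((n + 1 : ℕ) : ℝ≥0∞) ^ s) Filter.atTop (nhds ∞) :=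
    (ENNReal.tendsto_rpow_at_top hs).comp
      (ENNReal.tendsto_nat_nhds_top.comp (Filter.tendsto_add_atTop_nat 1))
  exact top_le_iff.1 (le_of_tendsto' h fun n => le_iSup (fun n : ℕ => ((n + 1 : ℕ) : ℝ≥0∞) ^ s) n)

theorem natCast_succ_rpow_le_one (n : ℕ) {s : ℝ} (hs : 0 ≤ s) :
    ((n + 1 : ℕ) : ℝ≥0) ^ (-s) ≤ 1 :=
  NNReal.rpow_le_one_of_one_le_of_nonpos (by exact_mod_cast Nat.le_add_left 1 n) (by linarith)

theorem le_two_pow_rpow {x : ℝ≥0} (hx : x ≤ 1) (k : ℕ) {p : ℝ} (hp : 1 ≤ p) :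
    (x : ℝ≥0∞) ≤ (2 ^ k : ℝ≥0∞) ^ (1 / p) :=
  le_trans (by exact_mod_cast hx)
    (ENNReal.one_le_rpow (one_le_pow₀ (by norm_num)) (by positivity))

theorem exists_space_open_range {p : ℝ} {q r₀ : ℝ≥0∞} (h : Admissible p q r₀) :
    ∃ (Z : Type) (_ : MetricSpace Z) (_ : MeasurableSpace Z) (_ : BorelSpace Z) (μ : Measure Z),
      IsStandard μ ∧ ¬ IsDoubling μ ∧ (∀ r ∈ Icc q r₀, bestConstant μ p q r = ∞) ∧
      (∀ r ∈ Ioc r₀ ∞, bestConstant μ p q r < ∞) := by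
  have hp := h.one_le_p
  have hp0 : 0 < p := by positivity
  have hq := h.one_le_q
  by_cases hr₀ : r₀ = ∞
  · obtain ⟨Z, i₁, i₂, i₃, μ, hs, hd, H⟩ := exists_space_of_array hp
      (fun _ k => ((2 : ℝ≥0) ^ k) ^ (1 / p)) (fun _ k => (NNReal.rpow_pos (by positivity)).ne')
      (fun _ k => by rw [ENNReal.coe_rpow_of_nonneg _ (by positivity)]; simp)
    refine ⟨Z, i₁, i₂, i₃, μ, hs, hd, fun r hr => ?_, fun r hr => ?_⟩
    · rw [← not_lt_top_iff, H q r (h.of_le hr.1), not_not, ← top_le_iff,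
        ← iSup_natCast_rpow_eq_top (s := 1 / p) (by positivity)]
      -- Here `D = 1`; the last entry of row `n` is `2^{n/p} ≥ (n+1)^{1/p}`, so even the sup norms
      -- are unbounded.
      refine iSup_mono fun n => le_trans ?_ (le_familyNorm (hq.trans hr.1) _ (Fin.last n))
      rw [ENNReal.coe_rpow_of_nonneg _ (by positivity), Fin.val_last]
      gcongr
      exact_mod_cast n.lt_two_pow_self
    · exact absurd hr.1 (by simp [hr₀])
  · have hr₀1 := one_le_toReal hr₀ (hq.trans h.le)
    obtain ⟨Z, i₁, i₂, i₃, μ, hs, hd, H⟩ := exists_space_of_array hp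
      (fun _ k => ((k + 1 : ℕ) : ℝ≥0) ^ (-(1 / r₀.toReal)))
      (fun _ k => (NNReal.rpow_pos (by positivity)).ne')
      (fun _ k => le_two_pow_rpow (natCast_succ_rpow_le_one k (by positivity)) k hp)
    have key : ∀ r, r ≠ ∞ → q ≤ r → (bestConstant μ p q r < ∞ ↔ r₀ < r) := by
      intro r hr hqr
      have hr1 := one_le_toReal hr (hq.trans hqr)
      rw [H q r (h.of_le hqr), iSup_familyNorm_fin_ne_top_iff hr (hq.trans hqr)
        fun k => ((((k + 1 : ℕ) : ℝ≥0) ^ (-(1 / r₀.toReal)) : ℝ≥0) : ℝ≥0∞)]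
      simp_rw [← ENNReal.coe_rpow_of_nonneg _ ENNReal.toReal_nonneg, ← NNReal.rpow_mul]
      -- The series `∑ (k+1)^{-r/r₀}` converges iff `r/r₀ > 1`.
      rw [ENNReal.tsum_coe_ne_top_iff_summable,
        NNReal.summable_nat_add_iff (f := fun k : ℕ => (k : ℝ≥0) ^ (-(1 / r₀.toReal) * r.toReal)) 1,
        NNReal.summable_rpow, ← ENNReal.toReal_lt_toReal hr₀ hr, neg_mul, neg_lt_neg_iff,
        one_div_mul_eq_div, one_lt_div (by positivity)]
    refine ⟨Z, i₁, i₂, i₃, μ, hs, hd, fun r hr => ?_, fun r hr => ?_⟩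
    · rw [← not_lt_top_iff, key r (ne_top_of_le_ne_top hr₀ hr.2) hr.1]
      exact not_lt.2 hr.2
    · have hqr := h.le.trans hr.1.le
      by_cases hrt : r = ∞
      · subst hrt
        refine (H q ∞ (h.of_le hqr)).2 (ne_top_of_le_ne_top ENNReal.one_ne_top ?_)
        exact iSup_le fun n => familyNorm_top_le fun k => by
          exact_mod_cast natCast_succ_rpow_le_one k (by positivity)
      · exact (key r hrt hqr).2 hr.1

theorem exists_space_closed_range {p : ℝ} {q r₀ : ℝ≥0∞} (h : Admissible p q r₀) :
    ∃ (Z : Type) (_ : MetricSpace Z) (_ : MeasurableSpace Z) (_ : BorelSpace Z) (μ : Measure Z),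
      IsStandard μ ∧ ¬ IsDoubling μ ∧ (∀ r ∈ Ico q r₀, bestConstant μ p q r = ∞) ∧
      (∀ r ∈ Icc r₀ ∞, bestConstant μ p q r < ∞) := by
  have hp := h.one_le_p
  have hq := h.one_le_q
  obtain ⟨Z, i₁, i₂, i₃, μ, hs, hd, H⟩ := exists_space_of_array hp
    -- For `r₀ = ∞` the conventions `toReal ∞ = 0` and `1 / 0 = 0` give the exponent 0, hence the
    -- constant array 1, which is the intended value of `1/r₀`.
    (fun n _ => ((n + 1 : ℕ) : ℝ≥0) ^ (-(1 / r₀.toReal)))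
    (fun n _ => (NNReal.rpow_pos (by positivity)).ne')
    (fun n k => le_two_pow_rpow (natCast_succ_rpow_le_one n (by positivity)) k hp)
  have hnorm : ∀ r, r ≠ ∞ → q ≤ r → ∀ n : ℕ, (familyNorm r fun _ : Fin (n + 1) =>
      ((((n + 1 : ℕ) : ℝ≥0) ^ (-(1 / r₀.toReal)) : ℝ≥0) : ℝ≥0∞)) =
        ((n + 1 : ℕ) : ℝ≥0∞) ^ (1 / r.toReal - 1 / r₀.toReal) := by
    intro r hr hqr n
    have hn : ((n + 1 : ℕ) : ℝ≥0∞) ≠ 0 := by exact_mod_cast n.succ_ne_zero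
    rw [familyNorm_fin_const hr (hq.trans hqr), ENNReal.coe_rpow_of_ne_zero (by positivity),
      ENNReal.coe_natCast, ← ENNReal.rpow_add _ _ hn (ENNReal.natCast_ne_top _), sub_eq_add_neg]
  refine ⟨Z, i₁, i₂, i₃, μ, hs, hd, fun r hr => ?_, fun r hr => ?_⟩
  · have hrt : r ≠ ∞ := hr.2.ne_top
    have hr1 := one_le_toReal hrt (hq.trans hr.1)
    rw [← not_lt_top_iff, H q r (h.of_le hr.1), not_not]
    simp_rw [hnorm r hrt hr.1]
    refine iSup_natCast_rpow_eq_top (sub_pos.2 ?_)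
    by_cases hr₀ : r₀ = ∞
    · rw [hr₀, ENNReal.toReal_top, div_zero]
      positivity
    · exact one_div_lt_one_div_of_lt (by positivity) ((ENNReal.toReal_lt_toReal hrt hr₀).2 hr.2)
  · have hqr := h.le.trans hr.1
    refine (H q r (h.of_le hqr)).2 (ne_top_of_le_ne_top ENNReal.one_ne_top (iSup_le fun n => ?_))
    by_cases hrt : r = ∞
    · subst hrt
      exact familyNorm_top_le fun k => by
        exact_mod_cast natCast_succ_rpow_le_one n (by positivity)
    · have hr₀ : r₀ ≠ ∞ := ne_top_of_le_ne_top hrt hr.1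
      have hr₀1 := one_le_toReal hr₀ (hq.trans h.le)
      rw [hnorm r hrt hqr]
      refine (ENNReal.rpow_le_rpow_of_exponent_le (z := 0)
        (by exact_mod_cast Nat.le_add_left 1 n) ?_).trans_eq ENNReal.rpow_zero
      exact sub_nonpos.2 (one_div_le_one_div_of_le (by positivity)
        (ENNReal.toReal_mono hrt hr.1))

end LorentzMaximal

theorem theorem4p2p1 (p₀ : ℝ) (q₀ r₀ : ℝ≥0∞) (h : LorentzMaximal.Admissible p₀ q₀ r₀) :
    (∃ (Z : Type) (_ : MetricSpace Z) (_ : MeasurableSpace Z) (_ : BorelSpace Z) (μ : Measure Z),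
      LorentzMaximal.IsStandard μ ∧ ¬ LorentzMaximal.IsDoubling μ ∧
      (∀ r ∈ Icc q₀ r₀, LorentzMaximal.bestConstant μ p₀ q₀ r = ∞) ∧
      (∀ r ∈ Ioc r₀ ∞, LorentzMaximal.bestConstant μ p₀ q₀ r < ∞)) ∧
    (∃ (Z : Type) (_ : MetricSpace Z) (_ : MeasurableSpace Z) (_ : BorelSpace Z) (μ : Measure Z),
      LorentzMaximal.IsStandard μ ∧ ¬ LorentzMaximal.IsDoubling μ ∧
      (∀ r ∈ Ico q₀ r₀, LorentzMaximal.bestConstant μ p₀ q₀ r = ∞) ∧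
      (∀ r ∈ Icc r₀ ∞, LorentzMaximal.bestConstant μ p₀ q₀ r < ∞)) :=
  ⟨LorentzMaximal.exists_space_open_range h, LorentzMaximal.exists_space_closed_range h⟩
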